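/- Let $I$ and $J$ be finite sets of agents and items, with $k_j\in\mathbb N$ units of item $j$. Agent $i$'s value $v_{ij}\ge 0$ for item $j$ has an arbitrary law $F_{ij}$, and all the values $v=(v_{ij})$ are independent. Call $A\subseteq I\times J$ a \emph{matching} if it contains at most one pair $(i,\cdot)$ for each agent $i$ and at most $k_j$ pairs $(\cdot,j)$ for each item $j$. Let $\mathcal I$ be the instance in which the feasible allocations are exactly the matchings, and let $r(S)$ be the maximum cardinality of a matching contained in $S\subseteq I\times J$. A \emph{lottery} is a pair $(q,p)$ with $q\in[0,1]^J$, $\sum_j q_j\le 1$ and a price $p\in\mathbb R$. A \emph{lottery-based mechanism} $M^{\mathcal L}$ for $\mathcal I$ offers agent $i$, at each value profile $v$, a set $\mathcal L_i(v)$ of lotteries that depends only on the values $v_{-i}$ of the other agents. Agent $i$ picks a lottery $\ell_i(v)=(q_{i\cdot}(v),p_i(v))$ that maximizes the utility $\sum_j q_j v_{ij}-p$ over the lotteries of $\mathcal L_i(v)$ and the option of buying nothing, i.e. the lottery $(0,0)$. It is required that $\sum_{(i,j)\in S}q_{ij}(v)\le r(S)$ for all $v$ and all $S\subseteq I\times J$.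 Its revenue is $\mathbf E_v\big[\sum_i p_i(v)\big]$. In the single-parameter instance $\mathcal I^{\mathrm{copies}}$ the agents are the pairs $(i,j)\in I\times J$, where agent $(i,j)$ has value $v_{ij}\sim F_{ij}$ for being served, the values are independent, and the sets of agents that may be served are the matchings. A (deterministic) mechanism for $\mathcal I^{\mathrm{copies}}$ maps each profile of bids to a matching of served agents and to a payment for each agent. It is \emph{truthful} if reporting the true value is a dominant strategy for every agent and a truthful agent never has negative utility. The expected revenue $\mathrm{Rev}^{\mathrm{Mye}}(\mathcal I^{\mathrm{copies}})$ of Myerson's (revenue-maximizing) mechanism is the supremum of the expected total payment over all truthful deterministic mechanisms for $\mathcal I^{\mathrm{copies}}$. Then for every such instance $\mathcal I$ and every lottery-based mechanism $M^{\mathcal L}$ for $\mathcal I$, the revenue of $M^{\mathcal L}$ is at most five times that of Myerson's mechanism: $$\mathbf E_v\Big[\sum_{i\in I} p_i(v)\Big]\;\le\;5\,\mathrm{Rev}^{\mathrm{Mye}}(\mathcal I^{\mathrm{copies}}).$$ -/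

import Mathlib

open MeasureTheory
open scoped NNReal ENNReal

noncomputable section

namespace BayesianMD

/-- Expectation of a real random variable, with values in `[-∞, ∞]`: the integral of the positive
part minus the integral of the negative part. -/
def expect {Ω : Type*} [MeasurableSpace Ω] (μ : Measure Ω) (f : Ω → ℝ) : EReal :=
  ((∫⁻ ω, ENNReal.ofReal (f ω) ∂μ : ℝ≥0∞) : EReal) -
    ((∫⁻ ω, ENNReal.ofReal (-f ω) ∂μ : ℝ≥0∞) : EReal)

/-! ### Single-parameter mechanism design -/

/-- An instance of Bayesian single-parameter mechanism design with set of agents `N`: the agents'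
nonnegative values for being served are independent, agent `e`'s value has law `dist e`, and the
sets in `feasible` are the sets of agents that may be served simultaneously. -/
structure BSMD (N : Type*) where
  dist : N → Measure ℝ≥0
  isProb : ∀ e, IsProbabilityMeasure (dist e)
  feasible : Set (Finset N)

/-- The joint law of the value profile. -/
def BSMD.law {N : Type*} [Fintype N] (𝓘 : BSMD N) : Measure (N → ℝ≥0) :=
  Measure.pi 𝓘.dist

/-- A deterministic direct mechanism: a bid profile is mapped to the set of agents served and to
the payment of every agent. -/
structure SPMechanism (N : Type*) where
  alloc : (N → ℝ≥0) → Finset N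
  pay : (N → ℝ≥0) → N → ℝ

namespace SPMechanism

variable {N : Type*} [DecidableEq N]

/-- Utility of agent `e` with true value `t` when the bid profile is `b`. -/
def utility (M : SPMechanism N) (e : N) (t : ℝ≥0) (b : N → ℝ≥0) : ℝ :=
  (if e ∈ M.alloc b then (t : ℝ) else 0) - M.pay b e

/-- Truthful reporting is a dominant strategy for every agent. -/
def Truthful (M : SPMechanism N) : Prop :=
  ∀ (v : N → ℝ≥0) (e : N) (b : ℝ≥0),
    M.utility e (v e) (Function.update v e b) ≤ M.utility e (v e) v

/-- Truthful agents never have negative utility. -/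
def IndividuallyRational (M : SPMechanism N) : Prop :=
  ∀ (v : N → ℝ≥0) (e : N), 0 ≤ M.utility e (v e) v

/-- The allocation rule and the payment rule are measurable. -/
def IsMeasurable (M : SPMechanism N) : Prop :=
  ∀ e : N, MeasurableSet {v | e ∈ M.alloc v} ∧ Measurable fun v => M.pay v e

/-- `M` is a truthful mechanism for the instance `𝓘`. -/
structure IsTruthfulFor (M : SPMechanism N) (𝓘 : BSMD N) : Prop where
  feasible : ∀ v, M.alloc v ∈ 𝓘.feasible
  truthful : M.Truthful
  rational : M.IndividuallyRational
  measurable : M.IsMeasurable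

/-- The expected total payment. -/
def expectedRevenue [Fintype N] (M : SPMechanism N) (𝓘 : BSMD N) : EReal :=
  expect 𝓘.law fun v => ∑ e, M.pay v e

end SPMechanism

/-- The expected revenue of Myerson's (revenue maximizing, deterministic) mechanism for the
instance `𝓘`: the supremum of the expected revenues of the truthful deterministic mechanisms. -/
def BSMD.myersonRevenue {N : Type*} [Fintype N] [DecidableEq N] (𝓘 : BSMD N) : EReal :=
  ⨆ (M : SPMechanism N) (_ : M.IsTruthfulFor 𝓘), M.expectedRevenue 𝓘

/-! ### Multi-parameter unit-demand mechanism design -/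

/-- An instance of Bayesian multi-parameter unit-demand mechanism design with agents `I`,
services `J` and independent nonnegative values: agent `i`'s value for service `j` has law
`dist i j`, and `feasible` is the set system of feasible allocations. -/
structure BMUMD (I J : Type*) where
  dist : I → J → Measure ℝ≥0
  isProb : ∀ i j, IsProbabilityMeasure (dist i j)
  feasible : Set (Finset (I × J))

namespace BMUMD

variable {I J : Type*}

/-- The joint law of the values `v (i, j)`. -/
def law [Fintype I] [Fintype J] (𝓘 : BMUMD I J) : Measure (I × J → ℝ≥0) :=
  Measure.pi fun e => 𝓘.dist e.1 e.2

/-- The single-parameter instance with copies: every agent `i` is split into pseudo-agents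
`(i, j)`, each interested in service `j` only, under the same feasibility constraint. -/
def copies (𝓘 : BMUMD I J) : BSMD (I × J) where
  dist e := 𝓘.dist e.1 e.2
  isProb e := 𝓘.isProb e.1 e.2
  feasible := 𝓘.feasible

open Classical in
/-- The largest cardinality of a feasible subset of `S`. -/
def rank (𝓘 : BMUMD I J) (S : Finset (I × J)) : ℕ :=
  (S.powerset.filter fun A => A ∈ 𝓘.feasible).sup Finset.card

end BMUMD

/-- The sets of agent-item pairs giving at most one item to each agent and item `j` to at most
`k j` agents. -/
def matchings {I J : Type*} [DecidableEq I] [DecidableEq J] (k : J → ℕ) :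
    Set (Finset (I × J)) :=
  {A | (∀ i, (A.filter fun e => e.1 = i).card ≤ 1) ∧ ∀ j, (A.filter fun e => e.2 = j).card ≤ k j}

/-- The multi-item matching setting: there are `k j` units of item `j`, and the feasible
allocations are exactly the matchings. -/
def BMUMD.IsMatchingSetting {I J : Type*} [DecidableEq I] [DecidableEq J] (𝓘 : BMUMD I J)
    (k : J → ℕ) : Prop :=
  𝓘.feasible = matchings k

/-! ### Lotteries -/

/-- A lottery over the services `J`. -/
structure Lottery (J : Type*) [Fintype J] where
  prob : J → ℝ
  price : ℝ
  prob_nonneg : ∀ j, 0 ≤ prob j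
  sum_prob_le_one : ∑ j, prob j ≤ 1

namespace Lottery

variable {J : Type*} [Fintype J]

/-- Buying no lottery. -/
def null : Lottery J where
  prob _ := 0
  price := 0
  prob_nonneg _ := le_rfl
  sum_prob_le_one := by simp

/-- Expected utility of a buyer with values `w` from the lottery. -/
def utility (l : Lottery J) (w : J → ℝ≥0) : ℝ :=
  ∑ j, l.prob j * (w j : ℝ) - l.price

end Lottery

/-- A lottery-based mechanism for the instance `𝓘`. At the value profile `v` agent `i` is offered
the lottery pricing `menu i v`, which depends only on the values of the other agents, and
`choice i v` is the lottery that agent `i` picks. -/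
structure LotteryMechanism {I J : Type*} [Fintype J] (𝓘 : BMUMD I J) where
  menu : I → (I × J → ℝ≥0) → Set (Lottery J)
  menu_congr : ∀ (i : I) (v v' : I × J → ℝ≥0),
    (∀ i' j, i' ≠ i → v (i', j) = v' (i', j)) → menu i v = menu i v'
  choice : I → (I × J → ℝ≥0) → Lottery J
  /-- the agent buys a lottery of the menu or nothing -/
  choice_mem : ∀ i v, choice i v ∈ insert Lottery.null (menu i v)
  /-- the agent maximizes utility -/
  choice_optimal : ∀ i v, ∀ l ∈ insert Lottery.null (menu i v),
    l.utility (fun j => v (i, j)) ≤ (choice i v).utility fun j => v (i, j)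
  feasible : ∀ (v : I × J → ℝ≥0) (S : Finset (I × J)),
    ∑ e ∈ S, (choice e.1 v).prob e.2 ≤ (𝓘.rank S : ℝ)
  measurable_prob : ∀ i j, Measurable fun v => (choice i v).prob j
  measurable_price : ∀ i, Measurable fun v => (choice i v).price

/-- The expected total price paid. -/
def LotteryMechanism.expectedRevenue {I J : Type*} [Fintype I] [Fintype J] {𝓘 : BMUMD I J}
    (L : LotteryMechanism 𝓘) : EReal :=
  expect 𝓘.law fun v => ∑ i, (L.choice i v).price

end BayesianMD

end

/-! Fix a profile `v` and let `G` be a matching of largest total value. With allocation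
probabilities q and agent utilities u ≥ 0, the prices sum to ∑ q_e v_e - ∑ u_i. Since `G` contains
each agent at most once, this is at most the surplus ∑_{e ∈ G} (q_e v_e - u_{e.1}) plus the value
∑_{e ∉ G} q_e v_e outside `G`. In expectation these cost one and four times Myerson's revenue R.

Surplus on `G`: draw θ uniformly from (0, 1] and serve the pairs of `G` with q_e ≥ θ, charging
threshold bids. Each θ gives a truthful mechanism. As a function of v_e alone, u is convex with
subgradient q_e, so the θ-average of the payment of e is at least q_e v_e - u
(`ofReal_le_lintegral_thresholds`).

Value outside `G`: write F(S) for the expected largest value of a matching inside a set S of pairs.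
VCG restricted to S raises at least ∑_{e ∈ S} F(S - e) - (|S| - 1) F(S), which is therefore at most
R. Averaging over S shows that a uniformly random S has mean F(S) at most (F(univ) + R)/2
(`two_mul_sum_le_of_sum_erase_le`). Conversely, let B be a matching disjoint from `G`. Inside a
random S one may keep `G ∩ S` and add each pair of B ∩ S whose at most two conflicts in `G` are
missed by S, so the optimum averages at least w(G)/2 + w(B)/8. As F(univ) = E w(G), comparison gives
E w(B) ≤ 4R. By Birkhoff's theorem some such B dominates the fractional allocation outside `G`. -/

noncomputable section

namespace BayesianMD

/-! ### Threshold payments for monotone allocation rules -/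

section Threshold

variable {N : Type*} [DecidableEq N]

/-- A winner stays a winner when it raises its bid. -/
def MonotoneAlloc (alloc : (N → ℝ≥0) → Finset N) : Prop :=
  ∀ (v : N → ℝ≥0) (e : N) (t : ℝ≥0), e ∈ alloc v → v e ≤ t → e ∈ alloc (Function.update v e t)

/-- The smallest bid with which `e` is served. -/
def threshold (alloc : (N → ℝ≥0) → Finset N) (v : N → ℝ≥0) (e : N) : ℝ≥0 :=
  sInf {t | e ∈ alloc (Function.update v e t)}

/-- The mechanism in which every winner pays its threshold. -/
def thresholdMechanism (alloc : (N → ℝ≥0) → Finset N) : SPMechanism N where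
  alloc := alloc
  pay v e := if e ∈ alloc v then (threshold alloc v e : ℝ) else 0

variable {alloc : (N → ℝ≥0) → Finset N}

theorem thresholdMechanism_pay_nonneg (v : N → ℝ≥0) (e : N) :
    0 ≤ (thresholdMechanism alloc).pay v e := by
  unfold thresholdMechanism
  dsimp only
  split_ifs <;> simp

theorem threshold_update (v : N → ℝ≥0) (e : N) (b : ℝ≥0) :
    threshold alloc (Function.update v e b) e = threshold alloc v e := by
  simp [threshold]

theorem threshold_le {v : N → ℝ≥0} {e : N} (h : e ∈ alloc v) : threshold alloc v e ≤ v e :=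
  csInf_le (OrderBot.bddBelow _) (by simpa using h)

theorem MonotoneAlloc.mem_of_mem_update (hm : MonotoneAlloc alloc) {v : N → ℝ≥0} {e : N}
    {s t : ℝ≥0} (h : e ∈ alloc (Function.update v e s)) (hst : s ≤ t) :
    e ∈ alloc (Function.update v e t) := by
  simpa using hm (Function.update v e s) e t h (by simpa using hst)

/-- A winning bid must exist: the infimum of the empty set in `ℝ≥0` is 0. -/
theorem MonotoneAlloc.le_threshold (hm : MonotoneAlloc alloc) {v : N → ℝ≥0} {e : N} {b : ℝ≥0}
    (hb : e ∈ alloc (Function.update v e b)) (h : e ∉ alloc v) : v e ≤ threshold alloc v e := by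
  refine le_csInf ⟨b, hb⟩ fun t ht => ?_
  by_contra! hlt
  exact h (by simpa using hm.mem_of_mem_update ht hlt.le)

/-- The threshold does not depend on the agent's own bid, so each agent faces a take-it-or-leave-it
price. -/
theorem thresholdMechanism_truthful (hm : MonotoneAlloc alloc) :
    (thresholdMechanism alloc).Truthful := by
  intro v e b
  simp only [SPMechanism.utility, thresholdMechanism, threshold_update]
  by_cases h1 : e ∈ alloc v
  · have := threshold_le h1
    have : (threshold alloc v e : ℝ) ≤ v e := by exact_mod_cast this
    by_cases h2 : e ∈ alloc (Function.update v e b) <;> simp [h1, h2, this]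
  · by_cases h2 : e ∈ alloc (Function.update v e b)
    · have := hm.le_threshold h2 h1
      simp [h1, h2, this]
    · simp [h1, h2]

theorem thresholdMechanism_rational : (thresholdMechanism alloc).IndividuallyRational := by
  intro v e
  simp only [SPMechanism.utility, thresholdMechanism]
  by_cases h1 : e ∈ alloc v
  · simpa [h1] using threshold_le h1
  · simp [h1]

/-- By monotonicity a winner's threshold is below `c` iff it still wins with some bid `r < c` from a
countable dense set. Joint measurability in the parameter `Θ` serves the later exchange of integrals
over cut levels and profiles. -/
theorem measurable_thresholdMechanism_pay {Θ : Type*} [MeasurableSpace Θ]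
    {alloc : Θ → (N → ℝ≥0) → Finset N} (hm : ∀ θ, MonotoneAlloc (alloc θ)) (e : N)
    (hA : MeasurableSet {p : Θ × (N → ℝ≥0) | e ∈ alloc p.1 p.2}) :
    Measurable fun p : Θ × (N → ℝ≥0) => (thresholdMechanism (alloc p.1)).pay p.2 e := by
  classical
  have hcast : (fun p : Θ × (N → ℝ≥0) => (thresholdMechanism (alloc p.1)).pay p.2 e) =
      fun p => ((if e ∈ alloc p.1 p.2 then threshold (alloc p.1) p.2 e else 0 : ℝ≥0) : ℝ) := by
    funext p
    simp only [thresholdMechanism]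
    split_ifs <;> simp
  rw [hcast]
  refine Measurable.coe_nnreal_real (measurable_of_Iio fun c => ?_)
  obtain ⟨D, hDc, hDd⟩ := TopologicalSpace.exists_countable_dense ℝ≥0
  -- `Iio 0` is empty; for positive `c` the preimage contains every loser, since losers pay 0.
  rcases eq_or_ne c 0 with rfl | hc
  · simp
  have hset : (fun p : Θ × (N → ℝ≥0) =>
      if e ∈ alloc p.1 p.2 then threshold (alloc p.1) p.2 e else 0) ⁻¹' Set.Iio c =
      {p | e ∈ alloc p.1 p.2}ᶜ ∪ ⋃ r ∈ D ∩ Set.Iio c,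
        (fun p : Θ × (N → ℝ≥0) => (p.1, Function.update p.2 e r)) ⁻¹'
          {p | e ∈ alloc p.1 p.2} := by
    ext p
    simp only [Set.mem_preimage, Set.mem_Iio, Set.mem_union, Set.mem_compl_iff,
      Set.mem_ofPred_eq, Set.mem_iUnion, Set.mem_inter_iff, exists_prop]
    by_cases h : e ∈ alloc p.1 p.2
    · simp only [h, if_true, not_true_eq_false, false_or]
      constructor
      · intro hlt
        obtain ⟨t, ht, htc⟩ := exists_lt_of_csInf_lt
          (s := {t | e ∈ alloc p.1 (Function.update p.2 e t)}) ⟨p.2 e, by simpa using h⟩ hlt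
        obtain ⟨r, hrD, hr1, hr2⟩ := hDd.exists_between htc
        exact ⟨r, ⟨hrD, hr2⟩, (hm p.1).mem_of_mem_update ht hr1.le⟩
      · rintro ⟨r, ⟨-, hrc⟩, hr⟩
        exact lt_of_le_of_lt (csInf_le' hr) hrc
    · simp [h, pos_iff_ne_zero.2 hc]
  rw [hset]
  refine hA.compl.union (MeasurableSet.biUnion (hDc.mono Set.inter_subset_left) fun r _ => ?_)
  refine hA.preimage (measurable_fst.prodMk ?_)
  refine measurable_pi_lambda _ fun a => ?_
  by_cases ha : a = e
  · subst ha; simp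
  · simpa [ha, Function.comp_def] using (measurable_pi_apply (X := fun _ : N => ℝ≥0) a).comp
      (measurable_snd (α := Θ))

theorem thresholdMechanism_isMeasurable (hm : MonotoneAlloc alloc)
    (hA : ∀ e, MeasurableSet {v | e ∈ alloc v}) : (thresholdMechanism alloc).IsMeasurable := by
  intro e
  refine ⟨hA e, ?_⟩
  have := measurable_thresholdMechanism_pay (Θ := Unit) (alloc := fun _ => alloc) (fun _ => hm) e
    ((hA e).preimage measurable_snd)
  exact this.comp ((measurable_const (a := ())).prodMk measurable_id)

theorem thresholdMechanism_isTruthfulFor {𝓘 : BSMD N} (hm : MonotoneAlloc alloc)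
    (hA : ∀ e, MeasurableSet {v | e ∈ alloc v}) (hf : ∀ v, alloc v ∈ 𝓘.feasible) :
    (thresholdMechanism alloc).IsTruthfulFor 𝓘 :=
  ⟨hf, thresholdMechanism_truthful hm, thresholdMechanism_rational,
    thresholdMechanism_isMeasurable hm hA⟩

theorem SPMechanism.IsTruthfulFor.lintegral_le_myersonRevenue [Fintype N] {𝓘 : BSMD N}
    {M : SPMechanism N} (hM : M.IsTruthfulFor 𝓘) (hpay : ∀ v e, 0 ≤ M.pay v e) :
    ((∫⁻ v, ENNReal.ofReal (∑ e, M.pay v e) ∂𝓘.law : ℝ≥0∞) : EReal) ≤ 𝓘.myersonRevenue := by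
  refine le_trans ?_ (le_iSup₂ (f := fun (M : SPMechanism N) (_ : M.IsTruthfulFor 𝓘) =>
    M.expectedRevenue 𝓘) M hM)
  have h0 : ∀ v, ENNReal.ofReal (-∑ e, M.pay v e) = 0 := fun v =>
    ENNReal.ofReal_of_nonpos (neg_nonpos.2 (Finset.sum_nonneg fun e _ => hpay v e))
  simp [SPMechanism.expectedRevenue, expect, h0]

end Threshold

/-! ### Largest-value feasible sets and VCG payments -/

section Winner

theorem sum_update_eq {N : Type*} [DecidableEq N] {v : N → ℝ≥0} {e : N} {t : ℝ≥0}
    (h : v e ≤ t) (B : Finset N) :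
    ∑ a ∈ B, Function.update v e t a = ∑ a ∈ B, v a + if e ∈ B then t - v e else 0 := by
  have : ∀ a, Function.update v e t a = v a + if a = e then t - v e else 0 := by
    intro a
    by_cases ha : a = e
    · subst ha; simp [add_tsub_cancel_of_le h]
    · simp [ha]
  simp only [this, Finset.sum_add_distrib, Finset.sum_ite_eq']

variable {N : Type*} [Fintype N]

/-- Total value of a set of agents, followed by an index that breaks ties. -/
def weightKey (v : N → ℝ≥0) (A : Finset N) : ℝ≥0 ×ₗ Fin (Fintype.card (Finset N)) :=
  toLex (∑ e ∈ A, v e, Fintype.equivFin (Finset N) A)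

theorem weightKey_injective (v : N → ℝ≥0) : Function.Injective (weightKey v) := by
  intro A B h
  have h2 := congrArg (fun x => (ofLex x).2) h
  exact (Fintype.equivFin (Finset N)).injective h2

theorem weightKey_le_iff {v : N → ℝ≥0} {A B : Finset N} :
    weightKey v B ≤ weightKey v A ↔ ∑ e ∈ B, v e < ∑ e ∈ A, v e ∨
      ∑ e ∈ B, v e = ∑ e ∈ A, v e ∧
        Fintype.equivFin (Finset N) B ≤ Fintype.equivFin (Finset N) A :=
  Prod.Lex.toLex_le_toLex

open Classical in
/-- The member of `F` of largest total value, with a fixed way of breaking ties. -/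
def winner (F : Finset (Finset N)) (v : N → ℝ≥0) : Finset N :=
  if h : F.Nonempty then (F.exists_max_image (weightKey v) h).choose else ∅

/-- The largest total value of a member of `F`. -/
def optValue (F : Finset (Finset N)) (v : N → ℝ≥0) : ℝ≥0 :=
  ∑ e ∈ winner F v, v e

variable {F : Finset (Finset N)} {v : N → ℝ≥0}

theorem winner_mem (hF : F.Nonempty) : winner F v ∈ F := by
  rw [winner, dif_pos hF]
  exact (F.exists_max_image (weightKey v) hF).choose_spec.1

theorem weightKey_le_winner {B : Finset N} (hB : B ∈ F) :
    weightKey v B ≤ weightKey v (winner F v) := by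
  have hF : F.Nonempty := ⟨B, hB⟩
  rw [winner, dif_pos hF]
  exact (F.exists_max_image (weightKey v) hF).choose_spec.2 B hB

theorem winner_eq_iff {A : Finset N} (hA : A ∈ F) :
    winner F v = A ↔ ∀ B ∈ F, weightKey v B ≤ weightKey v A := by
  constructor
  · rintro rfl B hB
    exact weightKey_le_winner hB
  · intro h
    exact weightKey_injective v (le_antisymm (h _ (winner_mem ⟨A, hA⟩)) (weightKey_le_winner hA))

theorem sum_le_optValue {B : Finset N} (hB : B ∈ F) : ∑ e ∈ B, v e ≤ optValue F v := by
  rcases weightKey_le_iff.1 (weightKey_le_winner (v := v) hB) with h | h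
  · exact h.le
  · exact h.1.le

variable [DecidableEq N]

/-- Raising the bid of `e` adds the same amount to every set containing `e` and nothing to the
others. The tie-breaking index ignores bids, so the winning set itself is unchanged. -/
theorem winner_update {e : N} {t : ℝ≥0} (he : e ∈ winner F v) (h : v e ≤ t) :
    winner F (Function.update v e t) = winner F v := by
  have hF : F.Nonempty := by
    by_contra hF
    simp [winner, hF] at he
  rw [winner_eq_iff (winner_mem hF)]
  intro B hB
  have hk := weightKey_le_iff.1 (weightKey_le_winner (v := v) hB)
  rw [weightKey_le_iff, sum_update_eq h, sum_update_eq h, if_pos he]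
  by_cases heB : e ∈ B
  · simpa [heB] using hk
  · simp only [heB, if_false, add_zero]
    rcases hk with hk | ⟨hk, hi⟩
    · exact Or.inl (hk.trans_le le_self_add)
    · rcases eq_or_ne (t - v e) 0 with h0 | h0
      · exact Or.inr ⟨by simp [h0, hk], hi⟩
      · exact Or.inl (by rw [hk]; exact lt_add_of_pos_right _ (pos_iff_ne_zero.2 h0))

theorem monotoneAlloc_winner (F : Finset (Finset N)) : MonotoneAlloc (winner F) := by
  intro v e t he h
  rwa [winner_update he h]

theorem measurableSet_winner_eq (A : Finset N) (hA : A ∈ F) :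
    MeasurableSet {v | winner F v = A} := by
  have : {v | winner F v = A} = ⋂ B ∈ F, {v | weightKey v B ≤ weightKey v A} := by
    ext v
    simp [winner_eq_iff hA]
  rw [this]
  refine Finset.measurableSet_biInter _ fun B _ => ?_
  have hm : ∀ C : Finset N, Measurable fun v : N → ℝ≥0 => ∑ e ∈ C, v e := fun C =>
    Finset.measurable_sum _ fun e _ => measurable_pi_apply e
  simp only [weightKey_le_iff]
  exact (measurableSet_lt (hm B) (hm A)).union
    ((measurableSet_eq_fun (hm B) (hm A)).inter (MeasurableSet.const _))

theorem measurableSet_mem_winner (e : N) : MeasurableSet {v | e ∈ winner F v} := by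
  classical
  have : {v | e ∈ winner F v} = ⋃ A ∈ F.filter (e ∈ ·), {v | winner F v = A} := by
    ext v
    simp only [Set.mem_ofPred_eq, Finset.mem_filter, Set.mem_iUnion, exists_prop]
    constructor
    · intro he
      have hF : F.Nonempty := by
        by_contra hF
        simp [winner, hF] at he
      exact ⟨_, ⟨winner_mem hF, he⟩, rfl⟩
    · rintro ⟨A, ⟨-, he⟩, rfl⟩
      exact he
  rw [this]
  exact Finset.measurableSet_biUnion _ fun A hA =>
    measurableSet_winner_eq A (Finset.mem_filter.1 hA).1

theorem measurable_optValue (F : Finset (Finset N)) : Measurable (optValue F) := by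
  classical
  have : optValue F = fun v => ∑ e, if e ∈ winner F v then v e else 0 := by
    funext v
    simp [optValue]
  rw [this]
  exact Finset.measurable_sum _ fun e _ =>
    Measurable.ite (measurableSet_mem_winner e) (measurable_pi_apply e) measurable_const

/-- A lower bound by the VCG externality. If `e` wins with bid `t` in the set `W`, then `W` beats
`F'` at bid `t`, and `W` is also a candidate at `v`; adding the two inequalities cancels the value
of `W.erase e`. -/
theorem optValue_add_le_threshold {e : N} (he : e ∈ winner F v)
    {F' : Finset (Finset N)} (hF' : F' ⊆ F) (hne : F'.Nonempty) (h : ∀ A ∈ F', e ∉ A) :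
    optValue F' v + v e ≤ optValue F v + threshold (winner F) v e := by
  rw [← tsub_le_iff_left]
  refine le_csInf ⟨v e, by simpa using he⟩ fun t ht => ?_
  rw [tsub_le_iff_left]
  set W := winner F (Function.update v e t) with hW
  have heW : e ∈ W := ht
  have hWF : W ∈ F := winner_mem (hne.mono hF')
  have h1 : ∀ A : Finset N, e ∉ A → ∑ a ∈ A, Function.update v e t a = ∑ a ∈ A, v a :=
    fun A hA => Finset.sum_congr rfl fun a ha =>
      Function.update_of_ne (by rintro rfl; exact hA ha) _ _
  have h2 := sum_le_optValue (v := Function.update v e t) (hF' (winner_mem (v := v) hne))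
  rw [h1 _ (h _ (winner_mem hne)), optValue, ← hW, ← Finset.add_sum_erase _ _ heW,
    h1 _ (Finset.notMem_erase _ _), Function.update_self] at h2
  have h3 := sum_le_optValue (v := v) hWF
  rw [← Finset.add_sum_erase _ _ heW] at h3
  calc optValue F' v + v e ≤ (t + ∑ a ∈ W.erase e, v a) + v e := by gcongr; exact h2
    _ = (v e + ∑ a ∈ W.erase e, v a) + t := by ring
    _ ≤ _ := by gcongr

/-- A winner `e` pays at least opt(S - e) - opt(S) + v_e; for a loser, opt(S - e) - opt(S) ≤ 0. On
summing, the winners' values add up to opt(S), which turns |S| into |S| - 1. -/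
theorem sum_optValue_erase_le_pay (F : Finset (Finset N)) (hF : ∅ ∈ F) (S : Finset N)
    (v : N → ℝ≥0) :
    ∑ e ∈ S, (optValue (F.filter (· ⊆ S.erase e)) v : ℝ) -
        ((S.card : ℝ) - 1) * optValue (F.filter (· ⊆ S)) v ≤
      ∑ e, (thresholdMechanism (winner (F.filter (· ⊆ S)))).pay v e := by
  set W := winner (F.filter (· ⊆ S)) v with hW
  have hWS : W ⊆ S := by
    have := winner_mem (F := F.filter (· ⊆ S)) (v := v) ⟨∅, by simp [hF]⟩
    exact (Finset.mem_filter.1 this).2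
  have key : ∀ e ∈ S, (optValue (F.filter (· ⊆ S.erase e)) v : ℝ) -
      optValue (F.filter (· ⊆ S)) v + (if e ∈ W then (v e : ℝ) else 0) ≤
      (thresholdMechanism (winner (F.filter (· ⊆ S)))).pay v e := by
    intro e _
    have hsub : F.filter (· ⊆ S.erase e) ⊆ F.filter (· ⊆ S) := fun A hA => by
      rw [Finset.mem_filter] at hA ⊢
      exact ⟨hA.1, hA.2.trans (Finset.erase_subset _ _)⟩
    have hne : (F.filter (· ⊆ S.erase e)).Nonempty := ⟨∅, by simp [hF]⟩
    by_cases he : e ∈ W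
    · have := optValue_add_le_threshold (v := v) he hsub hne fun A hA heA => by
        simpa using (Finset.mem_filter.1 hA).2 heA
      have : (optValue (F.filter (· ⊆ S.erase e)) v : ℝ) + v e ≤
        optValue (F.filter (· ⊆ S)) v + threshold (winner (F.filter (· ⊆ S))) v e := by
        exact_mod_cast this
      simp only [he, if_true, thresholdMechanism, ← hW]
      linarith
    · have := sum_le_optValue (v := v) (hsub (winner_mem (v := v) hne))
      have : (optValue (F.filter (· ⊆ S.erase e)) v : ℝ) ≤ optValue (F.filter (· ⊆ S)) v := by
        exact_mod_cast this
      simp only [he, if_false, thresholdMechanism, ← hW]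
      linarith
  have h1 := Finset.sum_le_sum key
  have h2 : ∑ e ∈ S, (thresholdMechanism (winner (F.filter (· ⊆ S)))).pay v e ≤
      ∑ e, (thresholdMechanism (winner (F.filter (· ⊆ S)))).pay v e :=
    Finset.sum_le_sum_of_subset_of_nonneg (Finset.subset_univ _) fun e _ _ =>
      thresholdMechanism_pay_nonneg v e
  have h3 : ∑ e ∈ S, (if e ∈ W then (v e : ℝ) else 0) = optValue (F.filter (· ⊆ S)) v := by
    rw [← Finset.sum_filter, Finset.filter_mem_eq_inter, Finset.inter_eq_right.2 hWS, optValue]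
    push_cast
    rfl
  rw [Finset.sum_add_distrib, Finset.sum_sub_distrib, h3, Finset.sum_const, nsmul_eq_mul] at h1
  linarith

end Winner

/-! ### Averages over random subsets -/

section Averaging

variable {N : Type*} [Fintype N] [DecidableEq N]

/-- Double counting: each `m`-set arises by deletion from `n - m` sets of size `m + 1`. -/
theorem sum_powersetCard_sum_erase (F : Finset N → ℝ) (m : ℕ) :
    ∑ S ∈ Finset.powersetCard (m + 1) (Finset.univ : Finset N), ∑ e ∈ S, F (S.erase e) =
      ((Fintype.card N - m : ℕ) : ℝ) * ∑ T ∈ Finset.powersetCard m (Finset.univ : Finset N), F T := by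
  have h : ((Fintype.card N - m : ℕ) : ℝ) *
      ∑ T ∈ Finset.powersetCard m (Finset.univ : Finset N), F T =
      ∑ T ∈ Finset.powersetCard m (Finset.univ : Finset N), ∑ _e ∈ Tᶜ, F T := by
    rw [Finset.mul_sum]
    refine Finset.sum_congr rfl fun T hT => ?_
    rw [Finset.sum_const, nsmul_eq_mul, Finset.card_compl, (Finset.mem_powersetCard.1 hT).2]
  rw [h, Finset.sum_sigma', Finset.sum_sigma']
  refine Finset.sum_bij' (fun x _ => ⟨x.1.erase x.2, x.2⟩) (fun x _ => ⟨insert x.2 x.1, x.2⟩)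
    ?_ ?_ ?_ ?_ ?_
  · rintro ⟨S, e⟩ hx
    simp only [Finset.mem_sigma, Finset.mem_powersetCard] at hx
    simp [Finset.mem_powersetCard, Finset.card_erase_of_mem hx.2, hx.1.2]
  · rintro ⟨T, e⟩ hx
    simp only [Finset.mem_sigma, Finset.mem_powersetCard, Finset.mem_compl] at hx
    simp [Finset.mem_powersetCard, Finset.card_insert_of_notMem hx.2, hx.1.2]
  · rintro ⟨S, e⟩ hx
    simp only [Finset.mem_sigma] at hx
    simp [Finset.insert_erase hx.2]
  · rintro ⟨T, e⟩ hx
    simp only [Finset.mem_sigma, Finset.mem_compl] at hx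
    simp [Finset.erase_insert hx.2]
  · rintro ⟨S, e⟩ _
    rfl

/-- The mean a_m of `F` over `m`-sets satisfies a_m ≤ R + (m/n)(F(univ) - R), here with denominators
cleared. There is equality at m = n, and summing `hF` over sets of size m + 1 gives (m + 1) a_m ≤ R
+ m a_{m+1}, which carries the bound downwards. -/
theorem sum_powersetCard_le (F : Finset N → ℝ) (R : ℝ)
    (hF : ∀ S : Finset N, ∑ e ∈ S, F (S.erase e) ≤ R + ((S.card : ℝ) - 1) * F S)
    (m : ℕ) (hm : m ≤ Fintype.card N) :
    (Fintype.card N : ℝ) * ∑ S ∈ Finset.powersetCard m (Finset.univ : Finset N), F S ≤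
      (Fintype.card N).choose m * (Fintype.card N * R + m * (F Finset.univ - R)) := by
  set n := Fintype.card N with hn
  induction hm using Nat.decreasingInduction with
  | self =>
    have : Finset.powersetCard n (Finset.univ : Finset N) = {Finset.univ} := by
      rw [hn, ← Finset.card_univ, Finset.powersetCard_self]
    simp [this]
    linarith
  | of_succ m hm ih =>
    set P := fun m => ∑ S ∈ Finset.powersetCard m (Finset.univ : Finset N), F S with hP
    have hstep : ((n - m : ℕ) : ℝ) * P m ≤ n.choose (m + 1) * R + m * P (m + 1) := by
      rw [hP, hn]
      dsimp only
      rw [← sum_powersetCard_sum_erase, ← hn]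
      refine (Finset.sum_le_sum fun S _ => hF S).trans (le_of_eq ?_)
      rw [Finset.sum_add_distrib, Finset.sum_const, Finset.card_powersetCard, Finset.card_univ,
        nsmul_eq_mul, Finset.mul_sum]
      congr 1
      refine Finset.sum_congr rfl fun S hS => ?_
      rw [(Finset.mem_powersetCard.1 hS).2]
      push_cast
      ring
    have hch : ((m : ℝ) + 1) * n.choose (m + 1) = n.choose m * ((n - m : ℕ) : ℝ) := by
      have := Nat.choose_succ_right_eq n m
      have : (n.choose (m + 1) : ℝ) * (m + 1) = n.choose m * ((n - m : ℕ) : ℝ) := by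
        exact_mod_cast this
      linarith
    have hpos : (0 : ℝ) < ((n - m : ℕ) : ℝ) := by
      exact_mod_cast Nat.sub_pos_of_lt hm
    refine le_of_mul_le_mul_left ?_ hpos
    push_cast at ih
    calc ((n - m : ℕ) : ℝ) * (n * P m) = n * (((n - m : ℕ) : ℝ) * P m) := by ring
      _ ≤ n * (n.choose (m + 1) * R + m * P (m + 1)) := by gcongr
      _ = n * n.choose (m + 1) * R + m * (n * P (m + 1)) := by ring
      _ ≤ n * n.choose (m + 1) * R +
          m * (n.choose (m + 1) * (n * R + (m + 1) * (F Finset.univ - R))) := by gcongr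
      _ = (((m : ℝ) + 1) * n.choose (m + 1)) * (n * R + m * (F Finset.univ - R)) := by ring
      _ = _ := by rw [hch]; ring

/-- A uniformly random subset has mean size n/2, so the linear bound in `m` averages to its
midpoint. -/
theorem two_mul_sum_le_of_sum_erase_le (F : Finset N → ℝ) (R : ℝ) (h0 : F ∅ ≤ R)
    (hF : ∀ S : Finset N, ∑ e ∈ S, F (S.erase e) ≤ R + ((S.card : ℝ) - 1) * F S) :
    2 * ∑ S, F S ≤ 2 ^ Fintype.card N * (F Finset.univ + R) := by
  have hsum : ∑ S, F S = ∑ m ∈ Finset.range (Fintype.card N + 1),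
      ∑ S ∈ Finset.powersetCard m (Finset.univ : Finset N), F S := by
    rw [← Finset.powerset_univ, Finset.sum_powerset, Finset.card_univ]
  -- With n = 0 one cannot cancel n; the claim is then `h0`.
  rcases Nat.eq_zero_or_pos (Fintype.card N) with h | h
  · have : IsEmpty N := Fintype.card_eq_zero_iff.1 h
    have hu : (Finset.univ : Finset N) = ∅ := Finset.univ_eq_empty
    rw [hsum, h, hu]
    simp
    linarith
  · set n := Fintype.card N with hn
    have hn0 : (0 : ℝ) < n := by exact_mod_cast h
    refine le_of_mul_le_mul_left ?_ hn0
    -- The mean of the binomial distribution, by the reflection m ↦ n - m.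
    have hid : ∑ m ∈ Finset.range (n + 1), (2 * (m : ℝ)) * n.choose m = n * 2 ^ n := by
      have h1 : ∑ m ∈ Finset.range (n + 1), (m : ℝ) * n.choose m =
          ∑ m ∈ Finset.range (n + 1), ((n : ℝ) - m) * n.choose m := by
        rw [← Finset.sum_range_reflect]
        refine Finset.sum_congr rfl fun m hm => ?_
        have hm' : m ≤ n := Nat.lt_succ_iff.1 (Finset.mem_range.1 hm)
        have : n + 1 - 1 - m = n - m := by omega
        rw [this, Nat.choose_symm hm', Nat.cast_sub hm']
      have h2 : ∑ m ∈ Finset.range (n + 1), (n : ℝ) * n.choose m = n * 2 ^ n := by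
        rw [← Finset.mul_sum]
        have := Nat.sum_range_choose n
        rw [show (∑ m ∈ Finset.range (n + 1), (n.choose m : ℝ)) = 2 ^ n by exact_mod_cast this]
      rw [← h2]
      simp only [sub_mul, Finset.sum_sub_distrib] at h1
      simp only [mul_assoc, ← Finset.mul_sum] at h1 ⊢
      linarith
    have hch : ∑ m ∈ Finset.range (n + 1), (n.choose m : ℝ) = 2 ^ n := by
      exact_mod_cast Nat.sum_range_choose n
    calc (n : ℝ) * (2 * ∑ S, F S)
        = 2 * ∑ m ∈ Finset.range (n + 1), (n : ℝ) *
          ∑ S ∈ Finset.powersetCard m (Finset.univ : Finset N), F S := by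
          rw [hsum, ← Finset.mul_sum]; ring
      _ ≤ 2 * ∑ m ∈ Finset.range (n + 1),
          n.choose m * (n * R + m * (F Finset.univ - R)) := by
          refine mul_le_mul_of_nonneg_left (Finset.sum_le_sum fun m hm => ?_) zero_le_two
          exact sum_powersetCard_le F R hF m (Nat.lt_succ_iff.1 (Finset.mem_range.1 hm))
      _ = 2 * n * R * ∑ m ∈ Finset.range (n + 1), (n.choose m : ℝ) + (F Finset.univ - R) *
          ∑ m ∈ Finset.range (n + 1), (2 * (m : ℝ)) * n.choose m := by
          rw [Finset.mul_sum, Finset.mul_sum, Finset.mul_sum, ← Finset.sum_add_distrib]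
          refine Finset.sum_congr rfl fun m _ => ?_
          ring
      _ = _ := by rw [hid, hch]; ring

/-- A uniformly random set contains `b` and misses `C` with probability at least 2^-(|C| + 1):
adjoin `b` to any set avoiding `b` and `C`. -/
theorem two_pow_le_mul_card_separating (b : N) (C : Finset N) :
    b ∉ C → 2 ^ Fintype.card N ≤ 2 ^ (C.card + 1) *
      (Finset.univ.filter fun S : Finset N => b ∈ S ∧ Disjoint C S).card := by
  intro hb
  have hcard : ((insert b C)ᶜ : Finset N).powerset.card ≤
      (Finset.univ.filter fun S : Finset N => b ∈ S ∧ Disjoint C S).card := by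
    refine Finset.card_le_card_of_injOn (insert b) ?_ ?_
    · intro S hS
      have hS' : S ⊆ (insert b C)ᶜ := Finset.mem_powerset.1 (Finset.mem_coe.1 hS)
      simp only [Finset.coe_filter, Finset.mem_univ, true_and, Set.mem_ofPred_eq,
        Finset.mem_insert_self, Finset.disjoint_insert_right]
      refine ⟨hb, Finset.disjoint_right.2 fun a ha haC => ?_⟩
      have := hS' ha
      simp [haC] at this
    · intro S hS T hT h
      have hb' : ∀ U : Finset N, U ∈ (((insert b C)ᶜ : Finset N).powerset : Set (Finset N)) →
          b ∉ U := by
        intro U hU hbU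
        have hU' : U ⊆ (insert b C)ᶜ := Finset.mem_powerset.1 (Finset.mem_coe.1 hU)
        simpa using hU' hbU
      rw [← Finset.erase_insert (hb' S hS), ← Finset.erase_insert (hb' T hT), h]
  have hle : C.card + 1 ≤ Fintype.card N := by
    rw [← Finset.card_insert_of_notMem hb]
    exact Finset.card_le_univ _
  rw [Finset.card_powerset, Finset.card_compl, Finset.card_insert_of_notMem hb] at hcard
  calc 2 ^ Fintype.card N = 2 ^ (C.card + 1) * 2 ^ (Fintype.card N - (C.card + 1)) := by
        rw [← pow_add, Nat.add_sub_cancel' hle]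
    _ ≤ _ := Nat.mul_le_mul_left _ hcard

end Averaging

/-! ### Combining two matchings on a random set of pairs -/

section Matchings

variable {I J : Type*} [DecidableEq I] [DecidableEq J] {k : J → ℕ}

theorem matchings_mono {A B : Finset (I × J)} (hB : B ∈ matchings k) (hAB : A ⊆ B) :
    A ∈ matchings k :=
  ⟨fun i => (Finset.card_le_card (Finset.filter_subset_filter _ hAB)).trans (hB.1 i),
    fun j => (Finset.card_le_card (Finset.filter_subset_filter _ hAB)).trans (hB.2 j)⟩

theorem empty_mem_matchings : (∅ : Finset (I × J)) ∈ matchings k := by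
  constructor <;> simp

theorem eq_of_mem_matchings {A : Finset (I × J)} (hA : A ∈ matchings k) {e e' : I × J}
    (he : e ∈ A) (he' : e' ∈ A) (h : e.1 = e'.1) : e = e' :=
  Finset.card_le_one.1 (hA.1 e'.1) e (by simp [he, h]) e' (by simp [he'])

/-- The units of every item can be assigned to the pairs of a matching. -/
theorem exists_slot {A : Finset (I × J)} (hA : A ∈ matchings k) :
    ∃ slot : I × J → ℕ, (∀ e ∈ A, slot e < k e.2) ∧
      ∀ e ∈ A, ∀ e' ∈ A, e.2 = e'.2 → slot e = slot e' → e = e' := by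
  have hmem : ∀ e ∈ A, e ∈ A.filter fun e' => e'.2 = e.2 := fun e he => by simp [he]
  refine ⟨fun e => if h : e ∈ A then
    ((A.filter fun e' => e'.2 = e.2).equivFin ⟨e, hmem e h⟩ : ℕ) else 0, ?_, ?_⟩
  · intro e he
    simp only [he, dif_pos]
    exact (Fin.is_lt _).trans_le (hA.2 e.2)
  · rintro ⟨i, j⟩ he ⟨i', j'⟩ he' h heq
    obtain rfl : j = j' := h
    simp only [he, he', dif_pos] at heq
    simpa using (Finset.equivFin _).injective (Fin.ext heq)

/-- Converse to `exists_slot`: assigned units turn the capacity bounds into conditions on two pairs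
at a time. -/
theorem mem_matchings_of_slot {A : Finset (I × J)} (slot : I × J → ℕ)
    (hrow : ∀ e ∈ A, ∀ e' ∈ A, e.1 = e'.1 → e = e') (hlt : ∀ e ∈ A, slot e < k e.2)
    (hinj : ∀ e ∈ A, ∀ e' ∈ A, e.2 = e'.2 → slot e = slot e' → e = e') : A ∈ matchings k := by
  constructor
  · intro i
    refine Finset.card_le_one.2 fun e he e' he' => ?_
    simp only [Finset.mem_filter] at he he'
    exact hrow e he.1 e' he'.1 (he.2.trans he'.2.symm)
  · intro j
    rw [← Finset.card_range (k j)]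
    refine Finset.card_le_card_of_injOn slot ?_ ?_
    · intro e he
      simp only [Finset.coe_filter, Set.mem_ofPred_eq] at he
      simpa [he.2] using hlt e he.1
    · intro e he e' he' h
      simp only [Finset.coe_filter, Set.mem_ofPred_eq] at he he'
      exact hinj e he.1 e' he'.1 (he.2.trans he'.2.symm) h

/-- If every pair of a matching `B` is kept only where it does not collide with the part of the
matching `G` inside `S`, the union is a matching; each pair of `B` collides with at most two pairs
of `G`. -/
theorem exists_conflicts {G B : Finset (I × J)} (hG : G ∈ matchings k) (hB : B ∈ matchings k) :
    ∃ conf : I × J → Finset (I × J), (∀ b, conf b ⊆ G ∧ (conf b).card ≤ 2) ∧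
      ∀ S, G ∩ S ∪ B.filter (fun b => b ∈ S ∧ Disjoint (conf b) S) ∈ matchings k := by
  obtain ⟨sG, hG1, hG2⟩ := exists_slot hG
  obtain ⟨sB, hB1, hB2⟩ := exists_slot hB
  -- A pair `b` conflicts with the pair of `G` having its agent and with the pair of `G` occupying
  -- its unit. Comparing units rather than items keeps the count at two for every capacity.
  refine ⟨fun b => (G.filter fun g => g.1 = b.1) ∪ G.filter fun g => g.2 = b.2 ∧ sG g = sB b,
    fun b => ⟨Finset.union_subset (Finset.filter_subset _ _) (Finset.filter_subset _ _), ?_⟩,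
    fun S => ?_⟩
  · refine (Finset.card_union_le _ _).trans ?_
    have h2 : (G.filter fun g => g.2 = b.2 ∧ sG g = sB b).card ≤ 1 := by
      refine Finset.card_le_one.2 fun e he e' he' => ?_
      simp only [Finset.mem_filter] at he he'
      exact hG2 e he.1 e' he'.1 (he.2.1.trans he'.2.1.symm) (he.2.2.trans he'.2.2.symm)
    have := hG.1 b.1
    omega
  · have hsep : ∀ g ∈ G ∩ S, ∀ b ∈ B.filter (fun b => b ∈ S ∧
        Disjoint ((G.filter fun g => g.1 = b.1) ∪ G.filter fun g => g.2 = b.2 ∧ sG g = sB b) S),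
        g.1 ≠ b.1 ∧ ¬ (g.2 = b.2 ∧ sG g = sB b) := by
      intro g hg b hb
      rw [Finset.mem_inter] at hg
      have hd := (Finset.mem_filter.1 hb).2.2
      have := Finset.disjoint_right.1 hd hg.2
      simpa [hg.1, not_or] using this
    set M := B.filter (fun b => b ∈ S ∧
        Disjoint ((G.filter fun g => g.1 = b.1) ∪ G.filter fun g => g.2 = b.2 ∧ sG g = sB b) S)
      with hM
    have hMB : ∀ b ∈ M, b ∈ B := fun b hb => (Finset.mem_filter.1 hb).1
    have hGS : ∀ g ∈ G ∩ S, g ∈ G := fun g hg => (Finset.mem_inter.1 hg).1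
    have hMG : ∀ b ∈ M, b ∉ G ∩ S := fun b hb hg => (hsep b hg b hb).1 rfl
    refine mem_matchings_of_slot (fun e => if e ∈ G ∩ S then sG e else sB e) ?_ ?_ ?_
    · intro e he e' he' h
      rcases Finset.mem_union.1 he with he | he <;> rcases Finset.mem_union.1 he' with he' | he'
      · exact eq_of_mem_matchings hG (hGS e he) (hGS e' he') h
      · exact absurd h (hsep e he e' he').1
      · exact absurd h.symm (hsep e' he' e he).1
      · exact eq_of_mem_matchings hB (hMB e he) (hMB e' he') h
    · intro e he
      rcases Finset.mem_union.1 he with he | he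
      · simpa only [he, if_true] using hG1 e (hGS e he)
      · simpa only [hMG e he, if_false] using hB1 e (hMB e he)
    · intro e he e' he' h hs
      rcases Finset.mem_union.1 he with he | he <;> rcases Finset.mem_union.1 he' with he' | he'
      · simp only [he, he', if_true] at hs
        exact hG2 e (hGS e he) e' (hGS e' he') h hs
      · simp only [he, hMG e' he', if_true, if_false] at hs
        exact absurd ⟨h, hs⟩ (hsep e he e' he').2
      · simp only [he', hMG e he, if_true, if_false] at hs
        exact absurd ⟨h.symm, hs.symm⟩ (hsep e' he' e he).2
      · simp only [hMG e he, hMG e' he', if_false] at hs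
        exact hB2 e (hMB e he) e' (hMB e' he') h hs

variable [Fintype I] [Fintype J]

open Classical in
/-- The finite set of all matchings. -/
def matchingFinset (I : Type*) [Fintype I] [DecidableEq I] (k : J → ℕ) :
    Finset (Finset (I × J)) :=
  Finset.univ.filter (· ∈ matchings k)

theorem mem_matchingFinset {A : Finset (I × J)} : A ∈ matchingFinset I k ↔ A ∈ matchings k := by
  simp [matchingFinset]

theorem winner_mem_matchings (k : J → ℕ) (v : I × J → ℝ≥0) :
    winner (matchingFinset I k) v ∈ matchings k :=
  mem_matchingFinset.1 (winner_mem ⟨∅, mem_matchingFinset.2 empty_mem_matchings⟩)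

/-- A pair of `G` lies in a random S with probability 1/2. A pair of `B` lies in S while its at most
two conflicts do not with probability at least 1/8. Doubling gives the weights 1 and 1/4. -/
theorem two_pow_mul_le_sum_optValue {G B : Finset (I × J)} (hG : G ∈ matchings k)
    (hB : B ∈ matchings k) (hGB : Disjoint G B) (v : I × J → ℝ≥0) :
    (2 : ℝ) ^ Fintype.card (I × J) * (∑ e ∈ G, (v e : ℝ) + 1 / 4 * ∑ e ∈ B, (v e : ℝ)) ≤
      2 * ∑ S, (optValue ((matchingFinset I k).filter (· ⊆ S)) v : ℝ) := by
  obtain ⟨conf, hconf, hM⟩ := exists_conflicts hG hB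
  have hS : ∀ S : Finset (I × J), ∑ e ∈ G, (if e ∈ S then (v e : ℝ) else 0) +
      ∑ b ∈ B, (if b ∈ S ∧ Disjoint (conf b) S then (v b : ℝ) else 0) ≤
      optValue ((matchingFinset I k).filter (· ⊆ S)) v := by
    intro S
    have hmem : G ∩ S ∪ B.filter (fun b => b ∈ S ∧ Disjoint (conf b) S) ∈
        (matchingFinset I k).filter (· ⊆ S) := by
      refine Finset.mem_filter.2 ⟨mem_matchingFinset.2 (hM S),
        Finset.union_subset Finset.inter_subset_right fun b hb => (Finset.mem_filter.1 hb).2.1⟩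
    have h := sum_le_optValue (v := v) hmem
    rw [Finset.sum_union (Finset.disjoint_of_subset_left Finset.inter_subset_left
      (Finset.disjoint_of_subset_right (Finset.filter_subset _ _) hGB))] at h
    rw [← Finset.sum_filter, ← Finset.sum_filter, Finset.filter_mem_eq_inter]
    exact_mod_cast h
  have h1 := Finset.sum_le_sum fun S (_ : S ∈ (Finset.univ : Finset (Finset (I × J)))) => hS S
  rw [Finset.sum_add_distrib, Finset.sum_comm, Finset.sum_comm (t := B)] at h1
  have hGle : ∑ e ∈ G, (2 : ℝ) ^ Fintype.card (I × J) * (v e : ℝ) ≤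
      2 * ∑ e ∈ G, ∑ S : Finset (I × J), (if e ∈ S then (v e : ℝ) else 0) := by
    rw [Finset.mul_sum]
    refine Finset.sum_le_sum fun e _ => ?_
    rw [← Finset.sum_filter, Finset.sum_const, nsmul_eq_mul, ← mul_assoc]
    have := two_pow_le_mul_card_separating e ∅ (by simp)
    simp only [Finset.card_empty, Finset.disjoint_empty_left, and_true, zero_add, pow_one] at this
    gcongr
    exact_mod_cast this
  have hBle : ∑ e ∈ B, (2 : ℝ) ^ Fintype.card (I × J) * (v e : ℝ) ≤
      8 * ∑ b ∈ B, ∑ S : Finset (I × J),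
        (if b ∈ S ∧ Disjoint (conf b) S then (v b : ℝ) else 0) := by
    rw [Finset.mul_sum]
    refine Finset.sum_le_sum fun e he => ?_
    rw [← Finset.sum_filter, Finset.sum_const, nsmul_eq_mul, ← mul_assoc]
    have h3 := two_pow_le_mul_card_separating e (conf e)
      fun h => Finset.disjoint_right.1 hGB he ((hconf e).1 h)
    have h4 : 2 ^ ((conf e).card + 1) ≤ 2 ^ 3 :=
      Nat.pow_le_pow_right (by norm_num) (by have := (hconf e).2; omega)
    have h5 := h3.trans (Nat.mul_le_mul_right _ h4)
    gcongr
    exact_mod_cast h5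
  rw [← Finset.mul_sum] at hGle hBle
  rw [mul_add]
  linarith

end Matchings

/-! ### Integrality from Birkhoff's theorem -/

section Birkhoff

variable {X Y : Type*} [Fintype X] [Fintype Y] [DecidableEq X] [DecidableEq Y]

/-- A linear function on doubly substochastic matrices is maximized by a partial matching. -/
theorem exists_perm_sum_ge (Q : X → Y → ℝ) (hQ : ∀ x y, 0 ≤ Q x y) (hrow : ∀ x, ∑ y, Q x y ≤ 1)
    (hcol : ∀ y, ∑ x, Q x y ≤ 1) (c : X → Y → ℝ) :
    ∃ σ : Equiv.Perm (X ⊕ Y), ∑ x, ∑ y, Q x y * c x y ≤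
      ∑ x, ∑ y, if σ (Sum.inl x) = Sum.inr y then c x y else 0 := by
  -- The row and column slacks on the diagonal, with the transpose of `Q` as fourth block, make `Q`
  -- a corner of a doubly stochastic matrix. A permutation matrix restricts to a partial matching
  -- there.
  let D : Matrix (X ⊕ Y) (X ⊕ Y) ℝ := Matrix.fromBlocks
    (Matrix.diagonal fun x => 1 - ∑ y, Q x y) (Matrix.of Q)
    (Matrix.of fun y x => Q x y) (Matrix.diagonal fun y => 1 - ∑ x, Q x y)
  have hD : D ∈ doublyStochastic ℝ (X ⊕ Y) := by
    rw [mem_doublyStochastic_iff_sum]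
    refine ⟨?_, ?_, ?_⟩
    · rintro (x | y) (x' | y')
      · simp only [D, Matrix.fromBlocks_apply₁₁, Matrix.diagonal_apply]
        split_ifs
        · linarith [hrow x]
        · exact le_rfl
      · exact hQ _ _
      · exact hQ _ _
      · simp only [D, Matrix.fromBlocks_apply₂₂, Matrix.diagonal_apply]
        split_ifs
        · linarith [hcol y]
        · exact le_rfl
    · rintro (x | y) <;> simp [D, Fintype.sum_sum_type, Matrix.diagonal_apply]
    · rintro (x | y) <;> simp [D, Fintype.sum_sum_type, Matrix.diagonal_apply]
  obtain ⟨w, hw0, hw1, hw⟩ := exists_eq_sum_perm_of_mem_doublyStochastic hD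
  have hQw : ∀ x y, Q x y = ∑ σ, w σ * if σ (Sum.inl x) = Sum.inr y then 1 else 0 := by
    intro x y
    have := congrFun (congrFun hw (Sum.inl x)) (Sum.inr y)
    simp only [D, Matrix.fromBlocks_apply₁₂, Matrix.of_apply, Matrix.sum_apply,
      Matrix.smul_apply, smul_eq_mul, Equiv.Perm.permMatrix, PEquiv.toMatrix_apply,
      Equiv.toPEquiv_apply, Option.mem_def, Option.some.injEq] at this
    exact this.symm
  set f : Equiv.Perm (X ⊕ Y) → ℝ := fun σ =>
    ∑ x, ∑ y, if σ (Sum.inl x) = Sum.inr y then c x y else 0 with hf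
  have hexp : ∑ x, ∑ y, Q x y * c x y = ∑ σ, w σ * f σ := by
    simp only [hf, Finset.mul_sum]
    rw [Finset.sum_comm (s := (Finset.univ : Finset (Equiv.Perm (X ⊕ Y))))]
    refine Finset.sum_congr rfl fun x _ => ?_
    rw [Finset.sum_comm (s := (Finset.univ : Finset (Equiv.Perm (X ⊕ Y))))]
    refine Finset.sum_congr rfl fun y _ => ?_
    rw [hQw, Finset.sum_mul]
    refine Finset.sum_congr rfl fun σ _ => ?_
    split_ifs <;> simp
  -- A convex combination cannot exceed all of its terms: all weights would vanish.
  by_contra! hlt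
  have h0 : ∑ σ, w σ * (∑ x, ∑ y, Q x y * c x y - f σ) = 0 := by
    simp only [mul_sub, Finset.sum_sub_distrib, ← Finset.sum_mul, hw1, one_mul, ← hexp, sub_self]
  have h1 := (Finset.sum_eq_zero_iff_of_nonneg fun σ _ =>
    mul_nonneg (hw0 σ) (sub_pos.2 (hlt σ)).le).1 h0
  have h2 : ∀ σ, w σ = 0 := fun σ =>
    (mul_eq_zero.1 (h1 σ (Finset.mem_univ σ))).resolve_right (sub_pos.2 (hlt σ)).ne'
  simp [h2] at hw1

end Birkhoff

/-! ### Fractional matchings with capacities -/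

section Integrality

variable {I J : Type*} [Fintype I] [Fintype J] [DecidableEq I] [DecidableEq J] {k : J → ℕ}

/-- A linear function on fractional matchings is maximized by a matching. -/
theorem exists_matching_sum_ge (q : I × J → ℝ) (hq : ∀ e, 0 ≤ q e)
    (hrow : ∀ i, ∑ j, q (i, j) ≤ 1) (hcol : ∀ j, ∑ i, q (i, j) ≤ k j) (c : I × J → ℝ) :
    ∃ B ∈ matchings k, ∑ e, q e * c e ≤ ∑ e ∈ B, c e := by
  classical
  -- Division by `k j = 0` returns 0, which is harmless because `q` vanishes on that item.
  have hk0 : ∀ i j, k j = 0 → q (i, j) = 0 := by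
    intro i j h
    have h1 : ∑ i, q (i, j) ≤ 0 := by simpa [h] using hcol j
    exact le_antisymm ((Finset.single_le_sum (f := fun i => q (i, j))
      (fun i _ => hq (i, j)) (Finset.mem_univ i)).trans h1) (hq _)
  have hsplit : ∀ (i : I) (j : J), (k j : ℝ) * (q (i, j) / k j) = q (i, j) := by
    intro i j
    rcases eq_or_ne (k j) 0 with h | h
    · simp [h, hk0 i j h]
    · have : (k j : ℝ) ≠ 0 := by exact_mod_cast h
      field_simp
  -- Split item `j` into `k j` unit copies that share `q` equally.
  obtain ⟨σ, hσ⟩ := exists_perm_sum_ge (X := I) (Y := Σ j, Fin (k j))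
    (fun i y => q (i, y.1) / k y.1) (fun i y => div_nonneg (hq _) (Nat.cast_nonneg _))
    (fun i => by
      rw [Fintype.sum_sigma]
      simpa [hsplit] using hrow i)
    (fun y => by
      rw [← Finset.sum_div]
      exact div_le_one_of_le₀ (hcol y.1) (Nat.cast_nonneg _))
    (fun i y => c (i, y.1))
  let B : Finset (I × J) := Finset.univ.filter fun e => ∃ s, σ (Sum.inl e.1) = Sum.inr ⟨e.2, s⟩
  let slot : I × J → ℕ := fun e =>
    if h : ∃ s, σ (Sum.inl e.1) = Sum.inr ⟨e.2, s⟩ then (h.choose : ℕ) else 0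
  have hB : ∀ e ∈ B, ∃ h : ∃ s, σ (Sum.inl e.1) = Sum.inr ⟨e.2, s⟩, slot e = (h.choose : ℕ) := by
    intro e he
    have h : ∃ s, σ (Sum.inl e.1) = Sum.inr ⟨e.2, s⟩ := by simpa [B] using he
    exact ⟨h, by simp only [slot, h, dif_pos]⟩
  refine ⟨B, mem_matchings_of_slot slot ?_ ?_ ?_, ?_⟩
  · rintro ⟨i, j⟩ he ⟨i', j'⟩ he' h
    obtain rfl : i = i' := h
    obtain ⟨⟨s, hs⟩, -⟩ := hB _ he
    obtain ⟨⟨s', hs'⟩, -⟩ := hB _ he'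
    have := Sum.inr_injective (hs.symm.trans hs')
    simp only [Sigma.mk.injEq] at this
    simp [this.1]
  · intro e he
    obtain ⟨h, hs⟩ := hB _ he
    rw [hs]
    exact Fin.is_lt _
  · rintro ⟨i, j⟩ he ⟨i', j'⟩ he' h heq
    obtain rfl : j = j' := h
    obtain ⟨h1, hs1⟩ := hB _ he
    obtain ⟨h2, hs2⟩ := hB _ he'
    have h3 : h1.choose = h2.choose := Fin.ext (hs1.symm.trans (heq.trans hs2))
    have h4 := h1.choose_spec
    rw [h3] at h4
    have := Sum.inl_injective (σ.injective (h4.trans h2.choose_spec.symm))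
    simpa using this
  · have hL : ∑ e, q e * c e = ∑ i, ∑ y : Σ j, Fin (k j), q (i, y.1) / k y.1 * c (i, y.1) := by
      rw [Fintype.sum_prod_type]
      refine Finset.sum_congr rfl fun i _ => ?_
      rw [Fintype.sum_sigma]
      refine Finset.sum_congr rfl fun j _ => ?_
      simp only [Finset.sum_const, Finset.card_univ, Fintype.card_fin, nsmul_eq_mul]
      rw [← mul_assoc, hsplit]
    have hR : ∑ e ∈ B, c e = ∑ i, ∑ y : Σ j, Fin (k j),
        if σ (Sum.inl i) = Sum.inr y then c (i, y.1) else 0 := by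
      rw [Finset.sum_filter, Fintype.sum_prod_type]
      refine Finset.sum_congr rfl fun i _ => ?_
      rw [Fintype.sum_sigma]
      refine Finset.sum_congr rfl fun j _ => ?_
      split_ifs with h
      · obtain ⟨s, hs⟩ := h
        dsimp only at hs
        rw [Finset.sum_eq_single s]
        · simp [hs]
        · intro s' _ hne
          rw [if_neg]
          intro h
          rw [hs] at h
          exact hne (by simpa using h.symm)
        · simp
      · rw [Finset.sum_eq_zero]
        intro s _
        rw [if_neg fun hs => h ⟨s, hs⟩]
    rw [hL, hR]
    exact hσ

/-- The part of a fractional matching outside the matching `G` is dominated by the average of the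
largest matchings in random sets of pairs. -/
theorem two_pow_mul_fractional_le_sum_optValue {G : Finset (I × J)} (hG : G ∈ matchings k)
    (q : I × J → ℝ) (hq : ∀ e, 0 ≤ q e) (hrow : ∀ i, ∑ j, q (i, j) ≤ 1)
    (hcol : ∀ j, ∑ i, q (i, j) ≤ k j) (v : I × J → ℝ≥0) :
    (2 : ℝ) ^ Fintype.card (I × J) *
        (∑ e ∈ G, (v e : ℝ) + 1 / 4 * ∑ e ∈ Gᶜ, q e * v e) ≤
      2 * ∑ S, (optValue ((matchingFinset I k).filter (· ⊆ S)) v : ℝ) := by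
  -- Weights vanish on `G`, so discarding `B ∩ G` afterwards costs nothing.
  obtain ⟨B, hB, hle⟩ := exists_matching_sum_ge q hq hrow hcol
    fun e => if e ∈ Gᶜ then (v e : ℝ) else 0
  have h1 : ∑ e ∈ Gᶜ, q e * v e ≤ ∑ e ∈ B \ G, (v e : ℝ) := by
    have h2 : ∑ e ∈ Gᶜ, q e * v e = ∑ e, q e * if e ∈ Gᶜ then (v e : ℝ) else 0 := by
      simp only [mul_ite, mul_zero]
      rw [← Finset.sum_filter, Finset.filter_mem_eq_inter, Finset.univ_inter]
    have h3 : ∑ e ∈ B \ G, (v e : ℝ) = ∑ e ∈ B, if e ∈ Gᶜ then (v e : ℝ) else 0 := by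
      rw [← Finset.sum_filter, Finset.filter_mem_eq_inter, Finset.sdiff_eq_inter_compl]
    rwa [h2, h3]
  refine le_trans ?_ (two_pow_mul_le_sum_optValue hG (matchings_mono hB Finset.sdiff_subset)
    Finset.disjoint_sdiff v)
  gcongr

end Integrality

/-! ### The envelope bound for a single value -/

/-- If `q s` is a subgradient at `s` of the nonnegative convex function `U`, then the posted prices
`τ θ` with `q` at least `θ` above `τ θ`, averaged over `θ`, raise at least `q v * v - U v` from a
buyer of value `v`. -/
theorem ofReal_le_lintegral_thresholds {q U : ℝ≥0 → ℝ} (hq0 : ∀ t, 0 ≤ q t) (hq1 : ∀ t, q t ≤ 1)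
    (hU : 0 ≤ U 0) (hsub : ∀ s t : ℝ≥0, U s + q s * ((t : ℝ) - s) ≤ U t) (v : ℝ≥0) (τ : ℝ → ℝ≥0)
    (hτ : ∀ θ ∈ Set.Ioc 0 (q v), ∀ s, q s < θ → s ≤ τ θ) :
    ENNReal.ofReal (q v * v - U v) ≤
      ∫⁻ θ in Set.Ioc 0 (1 : ℝ), ENNReal.ofReal (if θ ≤ q v then (τ θ : ℝ) else 0) := by
  have hmono : Monotone q := by
    intro s t hst
    rcases hst.eq_or_lt with rfl | hlt
    · rfl
    · have h1 := hsub s t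
      have h2 := hsub t s
      have h3 : (0 : ℝ) < t - s := by
        rw [sub_pos]
        exact_mod_cast hlt
      nlinarith
  -- Discretize along the grid 0, h, 2h, …. On `(q s, q t]` the price is at least the left endpoint
  -- `s`, and `U` grows by at least `q s * h`; using left endpoints costs the error term `-h`.
  -- Induction replaces integrating `q` or differentiating `U`.
  have hstep : ∀ h : ℝ≥0, ∀ n : ℕ, n * h ≤ v →
      ENNReal.ofReal ((((n * h : ℝ≥0) : ℝ) - h) * q (n * h) - U (n * h)) ≤
        ∫⁻ θ in Set.Ioc 0 (q (n * h)), (τ θ : ℝ≥0∞) := by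
    intro h n
    induction n with
    | zero =>
      intro _
      have : ENNReal.ofReal ((0 - (h : ℝ)) * q 0 - U 0) = 0 := by
        refine ENNReal.ofReal_of_nonpos ?_
        have := mul_nonneg h.2 (hq0 0)
        simp only [NNReal.val_eq_coe] at this
        linarith
      simpa using this.le.trans bot_le
    | succ n ih =>
      intro hn
      have hle : (n : ℝ≥0) * h ≤ ((n + 1 : ℕ) : ℝ≥0) * h := by
        gcongr
        exact n.le_succ
      have hqle := hmono hle
      have ih' := ih (hle.trans hn)
      set s : ℝ≥0 := n * h
      set t : ℝ≥0 := ((n + 1 : ℕ) : ℝ≥0) * h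
      have hts : (t : ℝ) = s + h := by
        simp only [s, t]
        push_cast
        ring
      have hU' : q s * h ≤ U t - U s := by
        have := hsub s t
        rw [hts] at this
        linarith
      have hpiece : ENNReal.ofReal (s * (q t - q s)) ≤
          ∫⁻ θ in Set.Ioc (q s) (q t), (τ θ : ℝ≥0∞) := by
        calc ENNReal.ofReal (s * (q t - q s)) = ∫⁻ _θ in Set.Ioc (q s) (q t), (s : ℝ≥0∞) := by
              rw [setLIntegral_const, Real.volume_Ioc, ENNReal.ofReal_mul s.coe_nonneg,
                ENNReal.ofReal_coe_nnreal]
          _ ≤ _ := by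
              refine setLIntegral_mono' measurableSet_Ioc fun θ hθ => ?_
              exact_mod_cast hτ θ ⟨(hq0 s).trans_lt hθ.1, hθ.2.trans (hmono hn)⟩ s hθ.1
      calc ENNReal.ofReal (((t : ℝ) - h) * q t - U t)
          ≤ ENNReal.ofReal (((s : ℝ) - h) * q s - U s) + ENNReal.ofReal (s * (q t - q s)) := by
            refine le_trans (ENNReal.ofReal_le_ofReal ?_) ENNReal.ofReal_add_le
            rw [hts]
            linarith
        _ ≤ (∫⁻ θ in Set.Ioc 0 (q s), (τ θ : ℝ≥0∞)) +
            ∫⁻ θ in Set.Ioc (q s) (q t), (τ θ : ℝ≥0∞) := add_le_add ih' hpiece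
        _ = _ := by
            rw [← lintegral_union measurableSet_Ioc (Set.Ioc_disjoint_Ioc_of_le le_rfl),
              Set.Ioc_union_Ioc_eq_Ioc (hq0 s) hqle]
  have hmain : ENNReal.ofReal (q v * v - U v) ≤ ∫⁻ θ in Set.Ioc 0 (q v), (τ θ : ℝ≥0∞) := by
    -- With mesh v/n the grid ends at `v`, and the error (v/n) q(v) tends to 0.
    have hlim : Filter.Tendsto
        (fun n : ℕ => ENNReal.ofReal (q v * v - U v - (v : ℝ) / n * q v)) Filter.atTop
        (nhds (ENNReal.ofReal (q v * v - U v - 0 * q v))) :=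
      ENNReal.tendsto_ofReal (tendsto_const_nhds.sub
        ((tendsto_const_div_atTop_nhds_zero_nat (v : ℝ)).mul_const _))
    rw [zero_mul, sub_zero] at hlim
    refine le_of_tendsto hlim (Filter.eventually_atTop.2 ⟨1, fun n hn => ?_⟩)
    have hn0 : (n : ℝ≥0) ≠ 0 := by
      exact_mod_cast (Nat.one_le_iff_ne_zero.1 hn)
    have hv : (n : ℝ≥0) * (v / n) = v := mul_div_cancel₀ _ hn0
    have := hstep (v / n) n hv.le
    rw [hv] at this
    refine le_trans (ENNReal.ofReal_le_ofReal (le_of_eq ?_)) this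
    push_cast
    ring
  refine hmain.trans ?_
  calc ∫⁻ θ in Set.Ioc 0 (q v), (τ θ : ℝ≥0∞)
      = ∫⁻ θ in Set.Ioc 0 (q v), ENNReal.ofReal (if θ ≤ q v then (τ θ : ℝ) else 0) := by
        refine setLIntegral_congr_fun measurableSet_Ioc fun θ hθ => ?_
        simp [hθ.2]
    _ ≤ _ := lintegral_mono_set (Set.Ioc_subset_Ioc_right (hq1 v))

/-! ### Utilities in a lottery mechanism and the cut allocations -/

namespace LotteryMechanism

variable {I J : Type*} [Fintype J] {𝓘 : BMUMD I J} (L : LotteryMechanism 𝓘)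

/-- The probability with which pair `e` is allocated. -/
def allocProb (v : I × J → ℝ≥0) (e : I × J) : ℝ :=
  (L.choice e.1 v).prob e.2

/-- The utility of agent `i`. -/
def agentUtility (v : I × J → ℝ≥0) (i : I) : ℝ :=
  (L.choice i v).utility fun j => v (i, j)

theorem allocProb_nonneg (v : I × J → ℝ≥0) (e : I × J) : 0 ≤ L.allocProb v e :=
  (L.choice e.1 v).prob_nonneg e.2

theorem sum_allocProb_le_one (v : I × J → ℝ≥0) (i : I) : ∑ j, L.allocProb v (i, j) ≤ 1 :=
  (L.choice i v).sum_prob_le_one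

theorem allocProb_le_one (v : I × J → ℝ≥0) (e : I × J) : L.allocProb v e ≤ 1 :=
  (Finset.single_le_sum (f := fun j => L.allocProb v (e.1, j))
    (fun j _ => L.allocProb_nonneg v (e.1, j)) (Finset.mem_univ e.2)).trans
    (L.sum_allocProb_le_one v e.1)

theorem agentUtility_nonneg (v : I × J → ℝ≥0) (i : I) : 0 ≤ L.agentUtility v i := by
  have := L.choice_optimal i v Lottery.null (Set.mem_insert _ _)
  simpa [Lottery.utility, Lottery.null, agentUtility] using this

theorem price_eq (v : I × J → ℝ≥0) (i : I) :
    (L.choice i v).price = ∑ j, L.allocProb v (i, j) * v (i, j) - L.agentUtility v i := by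
  simp [agentUtility, Lottery.utility, allocProb]

variable [DecidableEq I] [DecidableEq J]

/-- The menu ignores the agent's own values, so the lottery chosen at `s` is still available at `t`.
Its utility is affine in this value with slope the allocation probability, giving the left side. -/
theorem agentUtility_subgradient (v : I × J → ℝ≥0) (e : I × J) (s t : ℝ≥0) :
    L.agentUtility (Function.update v e s) e.1 +
        L.allocProb (Function.update v e s) e * ((t : ℝ) - s) ≤
      L.agentUtility (Function.update v e t) e.1 := by
  obtain ⟨i, j⟩ := e
  have hmenu : L.menu i (Function.update v (i, j) s) = L.menu i (Function.update v (i, j) t) := by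
    refine L.menu_congr i _ _ fun i' j' h => ?_
    have hne : (i', j') ≠ (i, j) := fun h' => h (congrArg Prod.fst h')
    simp [hne]
  have hmem := L.choice_mem i (Function.update v (i, j) s)
  rw [hmenu] at hmem
  refine le_trans (le_of_eq ?_) (L.choice_optimal i _ _ hmem)
  set l := L.choice i (Function.update v (i, j) s) with hl
  have hupd : ∀ (r : ℝ≥0) (j' : J), (Function.update v (i, j) r (i, j') : ℝ) =
      if j' = j then (r : ℝ) else v (i, j') := by
    intro r j'
    by_cases h : j' = j
    · subst h; simp
    · have hne : (i, j') ≠ (i, j) := fun h' => h (congrArg Prod.snd h')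
      simp [hne, h]
  have hsplit : ∀ r : ℝ≥0, ∑ j', l.prob j' * (Function.update v (i, j) r (i, j') : ℝ) =
      l.prob j * r + ∑ j' ∈ Finset.univ.erase j, l.prob j' * v (i, j') := by
    intro r
    rw [← Finset.add_sum_erase _ _ (Finset.mem_univ j), hupd, if_pos rfl]
    congr 1
    refine Finset.sum_congr rfl fun j' hj' => ?_
    rw [hupd, if_neg (Finset.ne_of_mem_erase hj')]
  simp only [agentUtility, allocProb, ← hl, Lottery.utility]
  rw [hsplit, hsplit]
  ring

theorem allocProb_mono (v : I × J → ℝ≥0) (e : I × J) :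
    Monotone fun t => L.allocProb (Function.update v e t) e := by
  intro s t hst
  rcases hst.eq_or_lt with rfl | hlt
  · rfl
  · have h1 := L.agentUtility_subgradient v e s t
    have h2 := L.agentUtility_subgradient v e t s
    have h3 : (0 : ℝ) < t - s := by
      rw [sub_pos]
      exact_mod_cast hlt
    dsimp only
    nlinarith

variable [Fintype I]

/-- Feasibility applied to all pairs with item `j`, a set of rank at most `k j`. -/
theorem sum_allocProb_le {k : J → ℕ} (h𝓘 : 𝓘.IsMatchingSetting k) (v : I × J → ℝ≥0) (j : J) :
    ∑ i, L.allocProb v (i, j) ≤ k j := by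
  classical
  have h := L.feasible v (Finset.univ.filter fun e : I × J => e.2 = j)
  have h1 : ∑ e ∈ Finset.univ.filter (fun e : I × J => e.2 = j), (L.choice e.1 v).prob e.2 =
      ∑ i, L.allocProb v (i, j) := by
    rw [Finset.sum_filter, Fintype.sum_prod_type]
    simp [allocProb]
  rw [h1] at h
  refine h.trans ?_
  have h2 : 𝓘.rank (Finset.univ.filter fun e : I × J => e.2 = j) ≤ k j := by
    refine Finset.sup_le fun A hA => ?_
    rw [Finset.mem_filter, Finset.mem_powerset, h𝓘] at hA
    have h3 := hA.2.2 j
    rwa [Finset.filter_true_of_mem fun e he => (Finset.mem_filter.1 (hA.1 he)).2] at h3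
  exact_mod_cast h2

/-- Serve the pairs of the largest matching that the lottery mechanism allocates with probability at
least `θ`. -/
def cutAlloc (k : J → ℕ) (θ : ℝ) (v : I × J → ℝ≥0) : Finset (I × J) :=
  (winner (matchingFinset I k) v).filter fun e => θ ≤ L.allocProb v e

theorem monotoneAlloc_cutAlloc (k : J → ℕ) (θ : ℝ) : MonotoneAlloc (L.cutAlloc k θ) := by
  intro v e t he h
  rw [cutAlloc, Finset.mem_filter] at he ⊢
  refine ⟨monotoneAlloc_winner _ v e t he.1 h, he.2.trans ?_⟩
  have := L.allocProb_mono v e h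
  simpa using this

theorem cutAlloc_mem_matchings (k : J → ℕ) (θ : ℝ) (v : I × J → ℝ≥0) :
    L.cutAlloc k θ v ∈ matchings k :=
  matchings_mono (winner_mem_matchings k v) (Finset.filter_subset _ _)

theorem measurableSet_mem_cutAlloc (k : J → ℕ) (e : I × J) :
    MeasurableSet {p : ℝ × (I × J → ℝ≥0) | e ∈ L.cutAlloc k p.1 p.2} := by
  simp only [cutAlloc, Finset.mem_filter]
  exact ((measurableSet_mem_winner e).preimage measurable_snd).inter
    (measurableSet_le measurable_fst ((L.measurable_prob e.1 e.2).comp measurable_snd))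

/-- The envelope bound in the coordinate `e`. A bid that wins under the cut `θ` has allocation
probability at least `θ`, so the threshold is no smaller than any bid whose probability is below
`θ`; having to be in the largest matching as well can only raise it. -/
theorem ofReal_surplus_le_lintegral_pay (k : J → ℕ) (v : I × J → ℝ≥0) {e : I × J}
    (he : e ∈ winner (matchingFinset I k) v) :
    ENNReal.ofReal (L.allocProb v e * v e - L.agentUtility v e.1) ≤
      ∫⁻ θ in Set.Ioc 0 (1 : ℝ),
        ENNReal.ofReal ((thresholdMechanism (L.cutAlloc k θ)).pay v e) := by
  have h := ofReal_le_lintegral_thresholds (q := fun t => L.allocProb (Function.update v e t) e)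
    (U := fun t => L.agentUtility (Function.update v e t) e.1)
    (fun t => L.allocProb_nonneg _ _) (fun t => L.allocProb_le_one _ _)
    (L.agentUtility_nonneg _ _) (L.agentUtility_subgradient v e) (v e)
    (fun θ => threshold (L.cutAlloc k θ) v e) (by
      intro θ hθ s hs
      simp only [Function.update_eq_self] at hθ
      refine le_csInf ⟨v e, ?_⟩ fun t ht => ?_
      · simpa [cutAlloc, he] using hθ.2
      · by_contra! hlt
        have h1 : θ ≤ L.allocProb (Function.update v e t) e := (Finset.mem_filter.1 ht).2
        exact absurd (h1.trans (L.allocProb_mono v e hlt.le)) (not_le.2 hs))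
  simp only [Function.update_eq_self] at h
  refine h.trans (le_of_eq ?_)
  refine lintegral_congr fun θ => ?_
  simp only [thresholdMechanism, cutAlloc, Finset.mem_filter, he, true_and]

/-- Each agent has at most one pair in the matching, so its nonnegative utility is subtracted at
most once. -/
theorem sum_price_le (k : J → ℕ) (v : I × J → ℝ≥0) :
    ∑ i, (L.choice i v).price ≤
      ∑ e ∈ winner (matchingFinset I k) v, (L.allocProb v e * v e - L.agentUtility v e.1) +
        ∑ e ∈ (winner (matchingFinset I k) v)ᶜ, L.allocProb v e * v e := by
  set G := winner (matchingFinset I k) v with hG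
  have hGm : G ∈ matchings k := winner_mem_matchings k v
  rw [Finset.sum_sub_distrib, sub_add_eq_add_sub, Finset.sum_add_sum_compl]
  have h1 : ∑ e ∈ G, L.agentUtility v e.1 ≤ ∑ i, L.agentUtility v i := by
    rw [← Finset.sum_fiberwise (s := G) (g := Prod.fst)]
    refine Finset.sum_le_sum fun i _ => ?_
    rw [Finset.sum_congr rfl fun e he => by rw [(Finset.mem_filter.1 he).2],
      Finset.sum_const, nsmul_eq_mul]
    have : (((G.filter fun e => e.1 = i).card : ℕ) : ℝ) ≤ 1 := by exact_mod_cast hGm.1 i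
    exact mul_le_of_le_one_left (L.agentUtility_nonneg v i) this
  simp only [price_eq, Finset.sum_sub_distrib]
  rw [Fintype.sum_prod_type]
  linarith

end LotteryMechanism

/-! ### Comparison with Myerson's revenue -/

section Revenue

variable {I J : Type*} [Fintype I] [Fintype J] [DecidableEq I] [DecidableEq J] {k : J → ℕ}
  {𝓘 : BMUMD I J}

instance BMUMD.law_isProbabilityMeasure (𝓘 : BMUMD I J) : IsProbabilityMeasure 𝓘.law := by
  have : ∀ e : I × J, IsProbabilityMeasure (𝓘.dist e.1 e.2) := fun e => 𝓘.isProb e.1 e.2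
  unfold BMUMD.law
  infer_instance

/-- The expected revenue of threshold prices is at most Myerson's revenue. -/
theorem lintegral_thresholdMechanism_le (h𝓘 : 𝓘.IsMatchingSetting k)
    {alloc : (I × J → ℝ≥0) → Finset (I × J)} (hm : MonotoneAlloc alloc)
    (hA : ∀ e, MeasurableSet {v | e ∈ alloc v}) (hf : ∀ v, alloc v ∈ matchings k) :
    ∫⁻ v, ENNReal.ofReal (∑ e, (thresholdMechanism alloc).pay v e) ∂𝓘.law ≤
      𝓘.copies.myersonRevenue.toENNReal := by
  have ht : (thresholdMechanism alloc).IsTruthfulFor 𝓘.copies :=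
    thresholdMechanism_isTruthfulFor hm hA fun v => by
      change alloc v ∈ 𝓘.feasible
      rw [h𝓘]
      exact hf v
  have := EReal.toENNReal_le_toENNReal
    (ht.lintegral_le_myersonRevenue fun v e => thresholdMechanism_pay_nonneg v e)
  rwa [EReal.toENNReal_coe] at this

/-- Serving nobody is truthful. This allows passing from `EReal` to `ℝ≥0∞` without loss. -/
theorem myersonRevenue_nonneg (h𝓘 : 𝓘.IsMatchingSetting k) : 0 ≤ 𝓘.copies.myersonRevenue := by
  have ht : (thresholdMechanism fun _ : I × J → ℝ≥0 => (∅ : Finset (I × J))).IsTruthfulFor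
      𝓘.copies :=
    thresholdMechanism_isTruthfulFor (fun _ _ _ h => absurd h (Finset.notMem_empty _))
      (fun e => by simp) fun v => by
      change ∅ ∈ 𝓘.feasible
      rw [h𝓘]
      exact empty_mem_matchings
  exact le_trans (EReal.coe_ennreal_nonneg _)
    (ht.lintegral_le_myersonRevenue fun v e => thresholdMechanism_pay_nonneg v e)

theorem winner_filter_mem_matchings (S : Finset (I × J)) (v : I × J → ℝ≥0) :
    winner ((matchingFinset I k).filter (· ⊆ S)) v ∈ matchings k := by
  have : winner ((matchingFinset I k).filter (· ⊆ S)) v ∈ (matchingFinset I k).filter (· ⊆ S) :=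
    winner_mem ⟨∅, by simp [mem_matchingFinset, empty_mem_matchings]⟩
  exact mem_matchingFinset.1 (Finset.mem_filter.1 this).1

theorem measurable_sum_compl_winner {q : (I × J → ℝ≥0) → I × J → ℝ}
    (hqm : ∀ e, Measurable fun v => q v e) :
    Measurable fun v => ∑ e ∈ (winner (matchingFinset I k) v)ᶜ, q v e * v e := by
  have : (fun v : I × J → ℝ≥0 => ∑ e ∈ (winner (matchingFinset I k) v)ᶜ, q v e * v e) =
      fun v => ∑ e, if e ∈ winner (matchingFinset I k) v then 0 else q v e * v e := by
    funext v
    rw [← Finset.sum_compl_add_sum (winner (matchingFinset I k) v),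
      Finset.sum_eq_zero (s := winner (matchingFinset I k) v) fun e he => if_pos he, add_zero]
    exact Finset.sum_congr rfl fun e he => (if_neg (Finset.mem_compl.1 he)).symm
  rw [this]
  exact Finset.measurable_sum _ fun e _ => Measurable.ite (measurableSet_mem_winner e)
    measurable_const ((hqm e).mul (measurable_pi_apply e).coe_nnreal_real)

/-- The value that a fractional matching generates outside the largest matching is, on bounded
value profiles, at most four times Myerson's revenue. -/
theorem setIntegral_compl_winner_le (h𝓘 : 𝓘.IsMatchingSetting k)
    (hR : 𝓘.copies.myersonRevenue.toENNReal ≠ ∞) {q : (I × J → ℝ≥0) → I × J → ℝ}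
    (hqm : ∀ e, Measurable fun v => q v e) (hq : ∀ v e, 0 ≤ q v e)
    (hrow : ∀ v i, ∑ j, q v (i, j) ≤ 1) (hcol : ∀ v j, ∑ i, q v (i, j) ≤ k j) (M : ℕ) :
    ∫⁻ v in {v | ∀ e, v e ≤ M}, ENNReal.ofReal
        (∑ e ∈ (winner (matchingFinset I k) v)ᶜ, q v e * v e) ∂𝓘.law ≤
      4 * 𝓘.copies.myersonRevenue.toENNReal := by
  set R := 𝓘.copies.myersonRevenue.toENNReal with hRdef
  -- Expected optima may be infinite, and the argument subtracts them. The VCG bound holds pointwise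
  -- and payments are nonnegative, so restricting to bounded profiles keeps the revenue bound.
  set ν := 𝓘.law.restrict {v | ∀ e, v e ≤ M} with hν
  have hD : MeasurableSet {v : I × J → ℝ≥0 | ∀ e, v e ≤ M} := by
    have : {v : I × J → ℝ≥0 | ∀ e, v e ≤ M} = ⋂ e, {v | v e ≤ (M : ℝ≥0)} := by
      ext v
      simp only [Set.mem_ofPred_eq, Set.mem_iInter]
    rw [this]
    exact MeasurableSet.iInter fun e => measurableSet_le (measurable_pi_apply e) measurable_const
  have hae : ∀ᵐ v ∂ν, ∀ e, (v e : ℝ) ≤ M := by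
    filter_upwards [ae_restrict_mem hD] with v hv e
    exact_mod_cast hv e
  have hint : ∀ f : (I × J → ℝ≥0) → ℝ, Measurable f → (∀ v, 0 ≤ f v) →
      (∀ v, f v ≤ ∑ e, (v e : ℝ)) → Integrable f ν := by
    intro f hf h0 h1
    refine Integrable.of_bound hf.aestronglyMeasurable (∑ _e : I × J, (M : ℝ)) ?_
    filter_upwards [hae] with v hv
    rw [Real.norm_of_nonneg (h0 v)]
    exact (h1 v).trans (Finset.sum_le_sum fun e _ => hv e)
  set F : Finset (I × J) → Finset (Finset (I × J)) :=
    fun S => (matchingFinset I k).filter (· ⊆ S) with hF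
  have hopt : ∀ S, Integrable (fun v => (optValue (F S) v : ℝ)) ν := by
    intro S
    refine hint _ (measurable_optValue _).coe_nnreal_real (fun v => NNReal.coe_nonneg _) fun v => ?_
    rw [optValue, NNReal.coe_sum]
    exact Finset.sum_le_sum_of_subset_of_nonneg (Finset.subset_univ _) fun e _ _ =>
      NNReal.coe_nonneg _
  have hpaym : ∀ S e, Measurable fun v => (thresholdMechanism (winner (F S))).pay v e :=
    fun S e => (thresholdMechanism_isMeasurable (monotoneAlloc_winner _)
      (fun e => measurableSet_mem_winner e) e).2
  have hpay : ∀ S, Integrable (fun v => ∑ e, (thresholdMechanism (winner (F S))).pay v e) ν := by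
    intro S
    refine hint _ (Finset.measurable_sum _ fun e _ => hpaym S e)
      (fun v => Finset.sum_nonneg fun e _ => thresholdMechanism_pay_nonneg v e) fun v => ?_
    refine Finset.sum_le_sum fun e _ => ?_
    have := (thresholdMechanism_rational (alloc := winner (F S))) v e
    rw [SPMechanism.utility] at this
    split_ifs at this
    · linarith
    · linarith [NNReal.coe_nonneg (v e)]
  have hrev : ∀ S, ∫ v, ∑ e, (thresholdMechanism (winner (F S))).pay v e ∂ν ≤ R.toReal := by
    intro S
    rw [← ENNReal.ofReal_le_iff_le_toReal hR, ofReal_integral_eq_lintegral_ofReal (hpay S)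
      (.of_forall fun v => Finset.sum_nonneg fun e _ => thresholdMechanism_pay_nonneg v e)]
    exact (lintegral_mono' Measure.restrict_le_self le_rfl).trans
      (lintegral_thresholdMechanism_le h𝓘 (monotoneAlloc_winner _)
        (fun e => measurableSet_mem_winner e) (winner_filter_mem_matchings S))
  -- The integrated VCG inequality is the hypothesis of the averaging lemma.
  have herase : ∀ S : Finset (I × J), ∑ e ∈ S, ∫ v, (optValue (F (S.erase e)) v : ℝ) ∂ν ≤
      R.toReal + ((S.card : ℝ) - 1) * ∫ v, (optValue (F S) v : ℝ) ∂ν := by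
    intro S
    rw [← sub_le_iff_le_add, ← integral_const_mul, ← integral_finsetSum _ fun e _ => hopt _,
      ← integral_sub (integrable_finsetSum _ fun e _ => hopt _) ((hopt S).const_mul _)]
    refine le_trans (integral_mono ((integrable_finsetSum _ fun e _ => hopt _).sub
      ((hopt S).const_mul _)) (hpay S) fun v => ?_) (hrev S)
    exact sum_optValue_erase_le_pay _ (mem_matchingFinset.2 empty_mem_matchings) S v
  have hF0 : ∫ v, (optValue (F ∅) v : ℝ) ∂ν ≤ R.toReal := by
    have : ∀ v, optValue (F ∅) v = 0 := by
      intro v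
      have hw : winner (F ∅) v ∈ F ∅ :=
        winner_mem ⟨∅, by simp [hF, mem_matchingFinset, empty_mem_matchings]⟩
      have : winner (F ∅) v = ∅ := Finset.subset_empty.1 (Finset.mem_filter.1 hw).2
      simp [optValue, this]
    simp [this]
  have havg := two_mul_sum_le_of_sum_erase_le (fun S => ∫ v, (optValue (F S) v : ℝ) ∂ν) R.toReal
    hF0 herase
  set b : (I × J → ℝ≥0) → ℝ :=
    fun v => ∑ e ∈ (winner (matchingFinset I k) v)ᶜ, q v e * v e with hb
  have hb0 : ∀ v, 0 ≤ b v := fun v =>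
    Finset.sum_nonneg fun e _ => mul_nonneg (hq v e) (NNReal.coe_nonneg _)
  have hbm : Measurable b := measurable_sum_compl_winner hqm
  have hbi : Integrable b ν := by
    refine hint b hbm hb0 fun v => ?_
    refine (Finset.sum_le_sum fun e _ => ?_).trans (Finset.sum_le_sum_of_subset_of_nonneg
      (Finset.subset_univ _) fun e _ _ => NNReal.coe_nonneg (v e))
    refine mul_le_of_le_one_left (NNReal.coe_nonneg _) ?_
    exact (Finset.single_le_sum (f := fun j => q v (e.1, j)) (fun j _ => hq v (e.1, j))
      (Finset.mem_univ e.2)).trans (hrow v e.1)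
  have hFu : F Finset.univ = matchingFinset I k := by simp [hF]
  have hpt : ∀ v, (2 : ℝ) ^ Fintype.card (I × J) * (optValue (F Finset.univ) v + 1 / 4 * b v) ≤
      2 * ∑ S, (optValue (F S) v : ℝ) := by
    intro v
    have := two_pow_mul_fractional_le_sum_optValue (winner_mem_matchings k v) (q v) (hq v)
      (hrow v) (hcol v) v
    rw [hFu, optValue, NNReal.coe_sum]
    exact this
  have hintg := integral_mono (μ := ν) ((((hopt Finset.univ).add (hbi.const_mul (1 / 4))).const_mul
    ((2 : ℝ) ^ Fintype.card (I × J)))) ((integrable_finsetSum _ fun S _ => hopt S).const_mul 2)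
    hpt
  have hsum : ∫ v, ((optValue (F Finset.univ) v : ℝ) + 1 / 4 * b v) ∂ν =
      ∫ v, (optValue (F Finset.univ) v : ℝ) ∂ν + 1 / 4 * ∫ v, b v ∂ν := by
    rw [integral_add (hopt _) (hbi.const_mul _), integral_const_mul]
  rw [integral_const_mul, integral_const_mul, integral_finsetSum _ fun S _ => hopt S] at hintg
  -- Lower and upper averages give E w(G) + E b / 4 ≤ E w(G) + R over `ν`; cancel the finite E w(G).
  have hfin : ∫ v, b v ∂ν ≤ 4 * R.toReal := by
    have h2 : (0 : ℝ) < 2 ^ Fintype.card (I × J) := by positivity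
    have h3 := le_of_mul_le_mul_left (hintg.trans havg) h2
    have h4 : ∫ v, ((optValue (F Finset.univ) v : ℝ) + 1 / 4 * b v) ∂ν ≤
      ∫ v, (optValue (F Finset.univ) v : ℝ) ∂ν + R.toReal := h3
    rw [hsum] at h4
    linarith
  rw [← ofReal_integral_eq_lintegral_ofReal hbi (.of_forall hb0)]
  refine (ENNReal.ofReal_le_ofReal hfin).trans ?_
  rw [ENNReal.ofReal_mul (by norm_num), ENNReal.ofReal_toReal hR]
  simp

/-- Bounded profiles exhaust the space, so monotone convergence removes the truncation. -/
theorem lintegral_compl_winner_le (h𝓘 : 𝓘.IsMatchingSetting k)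
    {q : (I × J → ℝ≥0) → I × J → ℝ}
    (hqm : ∀ e, Measurable fun v => q v e) (hq : ∀ v e, 0 ≤ q v e)
    (hrow : ∀ v i, ∑ j, q v (i, j) ≤ 1) (hcol : ∀ v j, ∑ i, q v (i, j) ≤ k j) :
    ∫⁻ v, ENNReal.ofReal (∑ e ∈ (winner (matchingFinset I k) v)ᶜ, q v e * v e) ∂𝓘.law ≤
      4 * 𝓘.copies.myersonRevenue.toENNReal := by
  by_cases hR : 𝓘.copies.myersonRevenue.toENNReal = ∞
  · simp [hR]
  · have hU : (⋃ M : ℕ, {v : I × J → ℝ≥0 | ∀ e, v e ≤ M}) = Set.univ := by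
      refine Set.eq_univ_of_forall fun v => Set.mem_iUnion.2 ?_
      obtain ⟨M, hM⟩ := exists_nat_ge (∑ e, v e)
      exact ⟨M, fun e => (Finset.single_le_sum (fun _ _ => bot_le) (Finset.mem_univ e)).trans hM⟩
    rw [← setLIntegral_univ, ← hU, setLIntegral_iUnion_of_directed]
    · exact iSup_le fun M => setIntegral_compl_winner_le h𝓘 hR hqm hq hrow hcol M
    · refine Monotone.directed_le fun M M' h v hv e => (hv e).trans ?_
      exact_mod_cast h

namespace LotteryMechanism

theorem measurable_cutAlloc_pay (L : LotteryMechanism 𝓘) (k : J → ℕ) (e : I × J) :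
    Measurable fun p : ℝ × (I × J → ℝ≥0) =>
      (thresholdMechanism (L.cutAlloc k p.1)).pay p.2 e :=
  measurable_thresholdMechanism_pay (L.monotoneAlloc_cutAlloc k) e
    (L.measurableSet_mem_cutAlloc k e)

/-- The positive part is subadditive, so the bounds for single pairs add up. -/
theorem ofReal_sum_surplus_le (L : LotteryMechanism 𝓘) (v : I × J → ℝ≥0) :
    ENNReal.ofReal (∑ e ∈ winner (matchingFinset I k) v,
        (L.allocProb v e * v e - L.agentUtility v e.1)) ≤
      ∫⁻ θ in Set.Ioc 0 (1 : ℝ),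
        ENNReal.ofReal (∑ e, (thresholdMechanism (L.cutAlloc k θ)).pay v e) := by
  have hpaym : ∀ e, Measurable fun θ : ℝ => (thresholdMechanism (L.cutAlloc k θ)).pay v e := by
    intro e
    have hv : Measurable fun θ : ℝ => (θ, v) := measurable_prodMk_right
    have := (L.measurable_cutAlloc_pay k e).comp hv
    simpa only [Function.comp_def] using this
  have hsum : ∀ θ : ℝ, ENNReal.ofReal (∑ e, (thresholdMechanism (L.cutAlloc k θ)).pay v e) =
      ∑ e, ENNReal.ofReal ((thresholdMechanism (L.cutAlloc k θ)).pay v e) := fun θ =>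
    ENNReal.ofReal_sum_of_nonneg fun e _ => thresholdMechanism_pay_nonneg v e
  simp only [hsum]
  rw [lintegral_finsetSum _ fun e _ => (hpaym e).ennreal_ofReal]
  refine (Finset.le_sum_of_subadditive _ ENNReal.ofReal_zero.le
    (fun _ _ => ENNReal.ofReal_add_le) _ _).trans ?_
  exact (Finset.sum_le_sum fun e he => L.ofReal_surplus_le_lintegral_pay k v he).trans
    (Finset.sum_le_sum_of_subset (Finset.subset_univ _))

/-- The surplus that the agents leave on the pairs of the largest matching is collected by threshold
prices. -/
theorem lintegral_surplus_le (L : LotteryMechanism 𝓘) (h𝓘 : 𝓘.IsMatchingSetting k) :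
    ∫⁻ v, ENNReal.ofReal (∑ e ∈ winner (matchingFinset I k) v,
        (L.allocProb v e * v e - L.agentUtility v e.1)) ∂𝓘.law ≤
      𝓘.copies.myersonRevenue.toENNReal := by
  have hjoint : Measurable fun p : ℝ × (I × J → ℝ≥0) =>
      ENNReal.ofReal (∑ e, (thresholdMechanism (L.cutAlloc k p.1)).pay p.2 e) :=
    (Finset.measurable_sum _ fun e _ => L.measurable_cutAlloc_pay k e).ennreal_ofReal
  refine (lintegral_mono fun v => L.ofReal_sum_surplus_le (k := k) v).trans ?_
  -- After the exchange, each fixed `θ` is a deterministic truthful mechanism, and `θ` ranges over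
  -- an interval of length 1.
  rw [lintegral_lintegral_swap (μ := 𝓘.law)
    (f := fun v θ => ENNReal.ofReal (∑ e, (thresholdMechanism (L.cutAlloc k θ)).pay v e))
    (hjoint.comp measurable_swap).aemeasurable]
  have hθ : ∀ θ : ℝ, ∫⁻ v, ENNReal.ofReal
      (∑ e, (thresholdMechanism (L.cutAlloc k θ)).pay v e) ∂𝓘.law ≤
      𝓘.copies.myersonRevenue.toENNReal := fun θ =>
    lintegral_thresholdMechanism_le h𝓘 (L.monotoneAlloc_cutAlloc k θ)
      (fun e => measurable_prodMk_left (x := θ) (L.measurableSet_mem_cutAlloc k e))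
      (L.cutAlloc_mem_matchings k θ)
  refine (lintegral_mono hθ).trans ?_
  simp

end LotteryMechanism

end Revenue

end BayesianMD

end

theorem mainTheorem5 {I J : Type*} [Fintype I] [Fintype J] [DecidableEq I] [DecidableEq J]
    (k : J → ℕ) (𝓘 : BayesianMD.BMUMD I J) (h𝓘 : 𝓘.IsMatchingSetting k)
    (L : BayesianMD.LotteryMechanism 𝓘) :
    L.expectedRevenue ≤ 5 * 𝓘.copies.myersonRevenue := by
  have hupper : L.expectedRevenue ≤
      ((∫⁻ v, ENNReal.ofReal (∑ i, (L.choice i v).price) ∂𝓘.law : ℝ≥0∞) : EReal) := by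
    refine add_le_of_nonpos_right ?_
    simpa using EReal.neg_le_neg_iff.2 (EReal.coe_ennreal_nonneg _)
  refine hupper.trans ?_
  rw [← EReal.coe_toENNReal (BayesianMD.myersonRevenue_nonneg h𝓘)]
  set R := 𝓘.copies.myersonRevenue.toENNReal with hR
  -- The five is 1 for the surplus on the largest matching plus 4 for the value outside it.
  have hprice : ∫⁻ v, ENNReal.ofReal (∑ i, (L.choice i v).price) ∂𝓘.law ≤ R + 4 * R := by
    refine le_trans (lintegral_mono fun v => (ENNReal.ofReal_le_ofReal
      (L.sum_price_le k v)).trans ENNReal.ofReal_add_le) ?_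
    rw [lintegral_add_right']
    · exact add_le_add (L.lintegral_surplus_le h𝓘) (BayesianMD.lintegral_compl_winner_le h𝓘
        (fun e => L.measurable_prob e.1 e.2) L.allocProb_nonneg L.sum_allocProb_le_one
        (L.sum_allocProb_le h𝓘))
    · exact (BayesianMD.measurable_sum_compl_winner
        fun e => L.measurable_prob e.1 e.2).ennreal_ofReal.aemeasurable
  have h5 : R + 4 * R = 5 * R := by ring
  rw [h5] at hprice
  refine (EReal.coe_ennreal_le_coe_ennreal_iff.2 hprice).trans (le_of_eq ?_)
  rw [EReal.coe_ennreal_mul]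
  rfl
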